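/- Let $\mathscr{U}$ be a finite set, let $\mathscr{Y}$ be a measurable space with a $\sigma$-finite measure $dy$, and let $p(\cdot\mid u)$, $u\in\mathscr{U}$, and $m$ be probability densities on $\mathscr{Y}$ with respect to $dy$. Let $\mathbb{F}$ be the simplex of probability vectors $f=\{f(u):u\in\mathscr{U}\}$ and, for $f\in\mathbb{F}$, put $m_f(y)=\sum_{u}p(y\mid u)f(u)$. Write $K(m,m')=\int\log\{m(y)/m'(y)\}\,m(y)\,dy\in[0,\infty]$ for the Kullback–Leibler divergence and $K^\star=\inf_{f\in\mathbb{F}}K(m,m_f)$. Assume that: (a) $f$ is identifiable: if $f,g\in\mathbb{F}$ and $m_f=m_g$ almost everywhere with respect to $m(y)\,dy$, then $f=g$; (b) $K(m,m_f)<\infty$ for all $f\in\mathbb{F}$; (c) the minimizer $f^\star\in\mathbb{F}$, $K(m,m_{f^\star})=K^\star$, lies in the interior of $\mathbb{F}$, i.e. $f^\star(u)>0$ for all $u$; (d) the weights $w_n\in(0,1)$, $n\ge1$, satisfy $\sum_n w_n=\infty$, $\sum_n w_n^{1+\varepsilon}<\infty$ for some $\varepsilon\in(0,1]$, and $w_{n+1}^{-1}-w_n^{-1}\to0$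 as $n\to\infty$. Let $Y_1,Y_2,\ldots$ be independent with common density $m$, let $f_0\in\mathbb{F}$ satisfy $f_0(u)>0$ for all $u$, and define the predictive recursion (PR) estimates by \[ f_n(u)=(1-w_n)f_{n-1}(u)+w_n\,\frac{p(Y_n\mid u)f_{n-1}(u)}{m_{n-1}(Y_n)},\qquad m_n=m_{f_n},\qquad n\ge1,\ u\in\mathscr{U}, \] with $m_0=m_{f_0}$. Then for every $\delta\in(0,(1-\varepsilon)/2]$, as $n\to\infty$, \[ \int|m_n-m_{f^\star}|\,dy=o(w_n^{\delta})\quad\text{almost surely}\qquad\text{and}\qquad K(m,m_n)-K^\star=o(w_n^{2\delta})\quad\text{almost surely.} \] -/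

import Mathlib

open MeasureTheory ProbabilityTheory Filter Topology Asymptotics

namespace PredRec

section

variable {𝒴 U : Type*} [MeasurableSpace 𝒴]

/-- `g` is a probability density on `𝒴` with respect to the dominating measure `ν` (written
`dy` in integrals). Integrability is implied by the integral being `1`. -/
structure IsDensity (ν : Measure 𝒴) (g : 𝒴 → ℝ) : Prop where
  measurable : Measurable g
  nonneg : ∀ y, 0 ≤ g y
  integral_eq_one : ∫ y, g y ∂ν = 1

/-- The measure `g(y) dy`. -/
noncomputable def law (ν : Measure 𝒴) (g : 𝒴 → ℝ) : Measure 𝒴 :=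
  ν.withDensity fun y => ENNReal.ofReal (g y)

/-- The Kullback-Leibler divergence `K(m, m') = ∫ log (m / m') m dy` of the density `m'` from the
density `m`, with values in `[0, ∞]`. -/
noncomputable def KL (ν : Measure 𝒴) (m m' : 𝒴 → ℝ) : ENNReal :=
  InformationTheory.klDiv (law ν m) (law ν m')

variable [Fintype U]

/-- The finite mixture `m_f(y) = ∑ u, p(y ∣ u) f(u)`. -/
def mixture (p : 𝒴 → U → ℝ) (f : U → ℝ) (y : 𝒴) : ℝ :=
  ∑ u, p y u * f u

/-- The infimum `K⋆` of `K(m, m_f)` over the probability simplex. -/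
noncomputable def KLinf (ν : Measure 𝒴) (m : 𝒴 → ℝ) (p : 𝒴 → U → ℝ) : ENNReal :=
  ⨅ f ∈ stdSimplex ℝ U, KL ν m (mixture p f)

/-- Identifiability: `f ↦ m_f` is one-to-one on the simplex, mixture densities being compared
up to null sets of the distribution `P` of an observation. -/
def Identifiable (P : Measure 𝒴) (p : 𝒴 → U → ℝ) : Prop :=
  ∀ f ∈ stdSimplex ℝ U, ∀ g ∈ stdSimplex ℝ U, mixture p f =ᵐ[P] mixture p g → f = g

/-- The predictive recursion estimate `f_n` of the mixing density, computed from the observations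
`y 1, …, y n` with the weights `w 1, …, w n` (the values at `0` are not used). -/
noncomputable def predRec (p : 𝒴 → U → ℝ) (w : ℕ → ℝ) (f₀ : U → ℝ) (y : ℕ → 𝒴) : ℕ → U → ℝ
  | 0 => f₀
  | n + 1 => fun u =>
      (1 - w (n + 1)) * predRec p w f₀ y n u +
        w (n + 1) * (p (y (n + 1)) u * predRec p w f₀ y n u /
          mixture p (predRec p w f₀ y n) (y (n + 1)))

end

end PredRec

/-!
Predictive recursion is a stochastic approximation scheme whose mean field vanishes, in the
interior of the simplex, only at the Kullback-Leibler minimizer `fs`. Perturbing `fs`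
inside the simplex gives the first-order conditions `∫ p(y ∣ u) / m_fs(y) m(y) dy = 1` for
every `u` (`IsRegular.integral_div_eq_one`), on which everything else rests.

*Consistency.* The divergence `∑ u, fs u * log (fs u / f u)` is a Lyapunov function. In one step it
decreases in mean by about `w * (∫ m_fs / m_f dμ - 1)`, where `μ` is the law of an observation. With
`t = m_fs / m_f`, the inequality `t + 1 / t ≥ 2` and `∫ 1 / t dμ = 1` make this positive unless
`f = fs`, by identifiability. No second moment of the ratios `p(· ∣ u) / m_f` is assumed, and they
are unbounded near the boundary of the simplex. Since the logarithm is increasing, they may be cut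
off at a level `M` before the logarithm is expanded (`divergence_step_le`); one `M` keeps the drift
positive on the whole simplex (`IsRegular.exists_truncation`), since the cut-off drift is
continuous up to the boundary and the cut-off is void near `fs`. The noise is then bounded, its
weighted series converges almost surely as an `L²`-bounded martingale (`ae_tendsto_sum_noise`), and
a deterministic argument on each path yields `f_n → fs` (`IsRegular.tendsto_of_noise`).

*Rate.* In the coordinates `(f u - fs u) / √(fs u)` the derivative of the mean field at `fs` is
minus a second-moment matrix, which identifiability makes positive definite
(`IsRegular.exists_dissipation`). As `2 * (1 - δ) ≥ 1 + ε`, the noise series with weights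
`w_n ^ (1 - δ)` converges almost surely. The deviation divided by `w_n ^ δ`, minus the tail of this
series, obeys a recursion contracting at a rate proportional to `w_n`; the rescaling costs only a
factor `1 + o(w_n)` because `w_{n+1}⁻¹ - w_n⁻¹ → 0`. Hence `f_n - fs = o(w_n ^ δ)`
(`isLittleO_rpow_of_recursion`).

The `L¹` distance of the mixtures is linear in `f_n - fs`, and the excess divergence is quadratic,
its first-order term being zero by the first-order conditions (`IsRegular.le_integral_log`).
-/

namespace PredRec

/-! ### Deterministic recursions -/

/-- The perturbation `κ n` enters with the same weight `w n` as the contraction, so it only has to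
tend to zero, not to be summable. -/
theorem tendsto_zero_of_contraction {u κ w : ℕ → ℝ} {c : ℝ} (hc : 0 < c)
    (hw0 : ∀ n, 0 ≤ w n) (hwt : Tendsto w atTop (𝓝 0))
    (hdiv : Tendsto (fun N => ∑ n ∈ Finset.range N, w n) atTop atTop)
    (hu : ∀ n, 0 ≤ u n) (hκ : Tendsto κ atTop (𝓝 0))
    (h : ∀ᶠ n in atTop, u (n + 1) ≤ (1 - c * w n) * u n + w n * κ n) :
    Tendsto u atTop (𝓝 0) := by
  rw [Metric.tendsto_atTop]
  intro η hη
  have h1 : ∀ᶠ n in atTop, c * w n < 1 := by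
    have : Tendsto (fun n => c * w n) atTop (𝓝 0) := by simpa using hwt.const_mul c
    exact this.eventually_lt_const one_pos
  have h2 : ∀ᶠ n in atTop, κ n < c * (η / 2) := hκ.eventually_lt_const (by positivity)
  obtain ⟨N, hN⟩ := eventually_atTop.1 (h.and (h1.and h2))
  set S : ℕ → ℝ := fun N => ∑ n ∈ Finset.range N, w n with hS
  have key : ∀ n, N ≤ n → u n - η / 2 ≤ Real.exp (-(c * (S n - S N))) * u N := by
    intro n hn
    induction n, hn using Nat.le_induction with
    | base => simp; linarith
    | succ n hn ih =>
      obtain ⟨a1, a2, a3⟩ := hN n hn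
      have e1 : S (n + 1) = S n + w n := by simp [hS, Finset.sum_range_succ]
      have e2 : Real.exp (-(c * (S (n + 1) - S N)))
          = Real.exp (-(c * w n)) * Real.exp (-(c * (S n - S N))) := by
        rw [← Real.exp_add, e1]; ring_nf
      have e3 : 1 - c * w n ≤ Real.exp (-(c * w n)) := by
        have := Real.add_one_le_exp (-(c * w n)); linarith
      have e4 : w n * κ n ≤ w n * (c * (η / 2)) := by
        have := hw0 n; gcongr
      have e5 : 0 ≤ Real.exp (-(c * (S n - S N))) * u N :=
        mul_nonneg (Real.exp_pos _).le (hu N)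
      calc u (n + 1) - η / 2 ≤ (1 - c * w n) * (u n - η / 2) := by linarith
        _ ≤ (1 - c * w n) * (Real.exp (-(c * (S n - S N))) * u N) := by
            apply mul_le_mul_of_nonneg_left ih; linarith
        _ ≤ Real.exp (-(c * w n)) * (Real.exp (-(c * (S n - S N))) * u N) := by
            apply mul_le_mul_of_nonneg_right e3 e5
        _ = _ := by rw [e2]; ring
  have lim : Tendsto (fun n => Real.exp (-(c * (S n - S N))) * u N) atTop (𝓝 0) := by
    have : Tendsto (fun n => c * (S n - S N)) atTop atTop :=
      (tendsto_atTop_add_const_right _ (-(S N)) hdiv).const_mul_atTop hc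
    simpa using (Real.tendsto_exp_neg_atTop_nhds_zero.comp this).mul_const (u N)
  obtain ⟨N', hN'⟩ := eventually_atTop.1 (lim.eventually_lt_const (half_pos hη))
  refine ⟨max N N', fun n hn => ?_⟩
  rw [Real.dist_0_eq_abs, abs_of_nonneg (hu n)]
  have := key n (le_trans (le_max_left _ _) hn)
  have := hN' n (le_trans (le_max_right _ _) hn)
  linarith

/-- A nonnegative Lyapunov sequence whose perturbations `s n` have a convergent series converges,
and since `∑ w n = ∞` the dissipation `Φ n` cannot stay away from zero. -/
theorem lyapunov_converges {D Φ w s : ℕ → ℝ} {S : ℝ} (hD : ∀ n, 0 ≤ D n) (hΦ : ∀ n, 0 ≤ Φ n)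
    (hw : ∀ n, 0 ≤ w n) (hdiv : Tendsto (fun N => ∑ n ∈ Finset.range N, w n) atTop atTop)
    (hs : Tendsto (fun N => ∑ n ∈ Finset.range N, s n) atTop (𝓝 S))
    (h : ∀ n, D (n + 1) ≤ D n - w n * Φ n + s n) :
    (∃ L, Tendsto D atTop (𝓝 L)) ∧ ∀ ε > 0, ∃ᶠ n in atTop, Φ n < ε := by
  obtain ⟨B, hB⟩ := hs.bddAbove_range
  have hB' : ∀ n, ∑ k ∈ Finset.range n, s k ≤ B := fun n => hB ⟨n, rfl⟩
  constructor
  · have anti : Antitone fun n => D n - ∑ k ∈ Finset.range n, s k := by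
      refine antitone_nat_of_succ_le fun n => ?_
      rw [Finset.sum_range_succ]
      have := h n; have := mul_nonneg (hw n) (hΦ n); linarith
    have bdd : BddBelow (Set.range fun n => D n - ∑ k ∈ Finset.range n, s k) := by
      refine ⟨-B, ?_⟩
      rintro _ ⟨n, rfl⟩
      have := hB' n; have := hD n
      simp only; linarith
    exact ⟨_, by simpa using (tendsto_atTop_ciInf anti bdd).add hs⟩
  · intro ε hε hcon
    have hcon' : ∀ᶠ n in atTop, ε ≤ Φ n := by simpa using hcon
    obtain ⟨N, hN⟩ := eventually_atTop.1 hcon'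
    have key : ∀ n, N ≤ n → D n + ε * ∑ k ∈ Finset.range n, w k - ∑ k ∈ Finset.range n, s k ≤
        D N + ε * ∑ k ∈ Finset.range N, w k - ∑ k ∈ Finset.range N, s k := by
      intro n hn
      induction n, hn using Nat.le_induction with
      | base => exact le_rfl
      | succ n hn ih =>
        rw [Finset.sum_range_succ, Finset.sum_range_succ]
        have := h n
        have := mul_le_mul_of_nonneg_left (hN n hn) (hw n)
        linarith
    have lim := hdiv.const_mul_atTop hε
    obtain ⟨n, hn1, hn2⟩ := ((lim.eventually_gt_atTop
      (D N + ε * ∑ k ∈ Finset.range N, w k - ∑ k ∈ Finset.range N, s k + B)).and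
      (eventually_ge_atTop N)).exists
    have := key n hn2; have := hD n; have := hB' n
    linarith

theorem abs_rpow_sub_one_le {t δ : ℝ} (ht : 0 < t) (h0 : 0 ≤ δ) (h1 : δ ≤ 1) :
    |t ^ δ - 1| ≤ |t - 1| := by
  rcases le_total 1 t with h | h
  · have a1 : 1 ≤ t ^ δ := Real.one_le_rpow h h0
    have a2 : t ^ δ ≤ t ^ (1 : ℝ) := Real.rpow_le_rpow_of_exponent_le h h1
    rw [Real.rpow_one] at a2
    rw [abs_of_nonneg (by linarith), abs_of_nonneg (by linarith)]; linarith
  · have a1 : t ^ δ ≤ 1 := Real.rpow_le_one ht.le h h0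
    have a2 : t ^ (1 : ℝ) ≤ t ^ δ := Real.rpow_le_rpow_of_exponent_ge ht h h1
    rw [Real.rpow_one] at a2
    rw [abs_of_nonpos (by linarith), abs_of_nonpos (by linarith)]; linarith

theorem norm_add_smul_le_of_dissipative {E : Type*} [NormedAddCommGroup E] [InnerProductSpace ℝ E]
    (A : E →L[ℝ] E) {c : ℝ} (hA : ∀ x, inner ℝ x (A x) ≤ -c * ‖x‖ ^ 2) {w : ℝ} (hw : 0 ≤ w)
    (h1 : w * ‖A‖ ^ 2 ≤ c) (h2 : c * w ≤ 1) (x : E) :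
    ‖x + w • A x‖ ≤ (1 - c / 2 * w) * ‖x‖ := by
  have hA1 : ‖A x‖ ^ 2 ≤ (‖A‖ * ‖x‖) ^ 2 := by
    have := A.le_opNorm x; gcongr
  have e : ‖x + w • A x‖ ^ 2 = ‖x‖ ^ 2 + 2 * (w * inner ℝ x (A x)) + w ^ 2 * ‖A x‖ ^ 2 := by
    rw [norm_add_sq_real, inner_smul_right, norm_smul, mul_pow, Real.norm_eq_abs, sq_abs]
  have b1 : w * inner ℝ x (A x) ≤ w * (-c * ‖x‖ ^ 2) := mul_le_mul_of_nonneg_left (hA x) hw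
  have b2 : w ^ 2 * ‖A x‖ ^ 2 ≤ w ^ 2 * (‖A‖ * ‖x‖) ^ 2 := by gcongr
  have b3 : w * ‖x‖ ^ 2 * (w * ‖A‖ ^ 2) ≤ w * ‖x‖ ^ 2 * c := by gcongr
  refine le_of_sq_le_sq ?_ ?_
  · rw [e]
    nlinarith [sq_nonneg (c / 2 * w * ‖x‖)]
  · refine mul_nonneg ?_ (norm_nonneg _)
    linarith

theorem tendsto_div_succ {w : ℕ → ℝ} (hw0 : ∀ n, 0 < w n) (hwt : Tendsto w atTop (𝓝 0))
    (hreg : Tendsto (fun n => (w (n + 1))⁻¹ - (w n)⁻¹) atTop (𝓝 0)) :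
    Tendsto (fun n => w n / w (n + 1)) atTop (𝓝 1) := by
  have : Tendsto (fun n => 1 + w n * ((w (n + 1))⁻¹ - (w n)⁻¹)) atTop (𝓝 (1 + 0 * 0)) :=
    (hwt.mul hreg).const_add 1
  simp only [mul_zero, add_zero] at this
  refine this.congr fun n => ?_
  have := (hw0 n).ne'; have := (hw0 (n + 1)).ne'
  field_simp; ring

/-- Convergence rate of a stochastic approximation recursion along one path. After rescaling by
`w n ^ (-δ)` and subtracting the tail of the noise series, the recursion is a contraction with
rate of order `w n`; the regularity of the weights makes the rescaling factor
`(w n / w (n + 1)) ^ δ` equal to `1 + o(w n)`, so that it does not spoil the contraction. -/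
theorem isLittleO_rpow_of_recursion {E : Type*} [NormedAddCommGroup E] [InnerProductSpace ℝ E]
    (A : E →L[ℝ] E) {c : ℝ} (hc : 0 < c) (hA : ∀ x, inner ℝ x (A x) ≤ -c * ‖x‖ ^ 2)
    {w : ℕ → ℝ} (hw0 : ∀ n, 0 < w n) (hwt : Tendsto w atTop (𝓝 0))
    (hdiv : Tendsto (fun N => ∑ n ∈ Finset.range N, w (n + 1)) atTop atTop)
    (hreg : Tendsto (fun n => (w (n + 1))⁻¹ - (w n)⁻¹) atTop (𝓝 0))
    {δ : ℝ} (hδ0 : 0 ≤ δ) (hδ1 : δ ≤ 1) {x ρ e : ℕ → E} {κ : ℕ → ℝ} {S : E}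
    (hx : ∀ n, x (n + 1) = x n + w (n + 1) • (A (x n) + ρ n + e n))
    (hρ : ∀ᶠ n in atTop, ‖ρ n‖ ≤ κ n * ‖x n‖) (hκ0 : ∀ n, 0 ≤ κ n)
    (hκ : Tendsto κ atTop (𝓝 0))
    (he : Tendsto (fun n => ∑ k ∈ Finset.range n, (w (k + 1)) ^ (1 - δ) • e k) atTop (𝓝 S)) :
    x =o[atTop] fun n => w n ^ δ := by
  have hwδ : ∀ n, 0 < w n ^ δ := fun n => Real.rpow_pos_of_pos (hw0 n) δ
  set θ : ℕ → ℝ := fun n => (w n / w (n + 1)) ^ δ with hθ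
  have hθ' : ∀ n, θ n = w n ^ δ / w (n + 1) ^ δ := fun n =>
    Real.div_rpow (hw0 n).le (hw0 (n + 1)).le δ
  set z : ℕ → E := fun n => (w n ^ δ)⁻¹ • x n with hz
  set N : ℕ → E := fun n => ∑ k ∈ Finset.range n, (w (k + 1)) ^ (1 - δ) • e k - S with hN
  have hN0 : Tendsto (fun n => ‖N n‖) atTop (𝓝 0) := by
    have := (he.sub_const S).norm
    simpa using this
  set y : ℕ → E := fun n => z n - N n with hy
  have hw1 : Tendsto (fun n => w (n + 1)) atTop (𝓝 0) := hwt.comp (tendsto_add_atTop_nat 1)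
  have hratio := tendsto_div_succ hw0 hwt hreg
  -- the rescaling factor is `1 + o(w)`
  have hθ1 : Tendsto (fun n => |θ n - 1| / w (n + 1)) atTop (𝓝 0) := by
    have lim : Tendsto (fun n => (w n / w (n + 1)) * |(w (n + 1))⁻¹ - (w n)⁻¹|) atTop (𝓝 0) := by
      simpa using hratio.mul hreg.abs
    refine squeeze_zero (fun n => div_nonneg (abs_nonneg _) (hw0 _).le) (fun n => ?_) lim
    have h1 := abs_rpow_sub_one_le (div_pos (hw0 n) (hw0 (n + 1))) hδ0 hδ1
    have h2 : w n / w (n + 1) - 1 = w n * ((w (n + 1))⁻¹ - (w n)⁻¹) := by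
      have := (hw0 n).ne'; have := (hw0 (n + 1)).ne'
      field_simp
    rw [h2, abs_mul, abs_of_pos (hw0 n)] at h1
    rw [div_le_iff₀ (hw0 _)]
    refine h1.trans (le_of_eq ?_)
    have := (hw0 (n + 1)).ne'
    field_simp
  have hθ2 : Tendsto (fun n => |θ n - 1|) atTop (𝓝 0) := by
    have := hθ1.mul hw1
    rw [mul_zero] at this
    refine this.congr fun n => ?_
    have := (hw0 (n + 1)).ne'
    field_simp
  set κ₁ : ℕ → ℝ := fun n => |θ n - 1| / w (n + 1) + |θ n - 1| * ‖A‖ + (|θ n - 1| + 1) * κ n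
    with hκ₁
  have hκ₁0 : Tendsto κ₁ atTop (𝓝 0) := by
    have := (hθ1.add (hθ2.mul_const ‖A‖)).add ((hθ2.add_const 1).mul hκ)
    simpa using this
  have hrec : ∀ n, y (n + 1) = (y n + w (n + 1) • A (y n)) +
      w (n + 1) • (((θ n - 1) / w (n + 1)) • z n + (θ n - 1) • A (z n) + A (N n) +
        (θ n * (w n ^ δ)⁻¹) • ρ n) := by
    intro n
    have hw := (hw0 (n + 1)).ne'
    have e1 : z (n + 1) = θ n • z n + (w (n + 1) * θ n) • A (z n) +
        (w (n + 1) * (θ n * (w n ^ δ)⁻¹)) • ρ n + (w (n + 1)) ^ (1 - δ) • e n := by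
      have c1 : (w (n + 1) ^ δ)⁻¹ = θ n * (w n ^ δ)⁻¹ := by
        rw [hθ']; have := (hwδ n).ne'; have := (hwδ (n + 1)).ne'; field_simp
      have c2 : w (n + 1) ^ (1 - δ) = w (n + 1) * (w (n + 1) ^ δ)⁻¹ := by
        rw [Real.rpow_sub (hw0 _), Real.rpow_one, div_eq_mul_inv]
      simp only [hz, hx n, c2, c1, map_smul]
      module
    have e2 : N (n + 1) = N n + (w (n + 1)) ^ (1 - δ) • e n := by
      simp only [hN, Finset.sum_range_succ]; abel
    have e3 : w (n + 1) • (((θ n - 1) / w (n + 1)) • z n) = (θ n - 1) • z n := by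
      rw [smul_smul, mul_div_cancel₀ _ hw]
    simp only [smul_add, e3]
    simp only [hy, e1, e2, map_sub]
    module
  have hev : ∀ᶠ n in atTop, ‖y (n + 1)‖ ≤ (1 - c / 4 * w (n + 1)) * ‖y n‖ +
      w (n + 1) * ((κ₁ n + ‖A‖) * ‖N n‖) := by
    have h1 : ∀ᶠ n in atTop, w (n + 1) * ‖A‖ ^ 2 < c := by
      have : Tendsto (fun n => w (n + 1) * ‖A‖ ^ 2) atTop (𝓝 0) := by
        simpa using hw1.mul_const (‖A‖ ^ 2)
      exact this.eventually_lt_const hc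
    have h2 : ∀ᶠ n in atTop, c * w (n + 1) < 1 := by
      have : Tendsto (fun n => c * w (n + 1)) atTop (𝓝 0) := by
        simpa using hw1.const_mul c
      exact this.eventually_lt_const one_pos
    have h3 : ∀ᶠ n in atTop, κ₁ n < c / 4 := hκ₁0.eventually_lt_const (by positivity)
    filter_upwards [h1, h2, h3, hρ] with n h1 h2 h3 h4
    have hwn := hw0 (n + 1)
    have hz0 : ‖(θ n * (w n ^ δ)⁻¹) • ρ n‖ ≤ (|θ n - 1| + 1) * κ n * ‖z n‖ := by
      have t1 : |θ n| ≤ |θ n - 1| + 1 := by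
        have := abs_add_le (θ n - 1) 1; simpa using this
      have t2 : ‖z n‖ = (w n ^ δ)⁻¹ * ‖x n‖ := by
        rw [hz, norm_smul, Real.norm_eq_abs, abs_of_pos (inv_pos.2 (hwδ n))]
      have t3 := inv_pos.2 (hwδ n)
      have t4 : 0 ≤ κ n * ‖x n‖ := (norm_nonneg _).trans h4
      rw [norm_smul, norm_mul, Real.norm_eq_abs, Real.norm_eq_abs, abs_of_pos t3, t2]
      calc |θ n| * (w n ^ δ)⁻¹ * ‖ρ n‖ ≤ |θ n| * (w n ^ δ)⁻¹ * (κ n * ‖x n‖) := by gcongr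
        _ ≤ (|θ n - 1| + 1) * (w n ^ δ)⁻¹ * (κ n * ‖x n‖) := by gcongr
        _ = _ := by ring
    have hr : ‖((θ n - 1) / w (n + 1)) • z n + (θ n - 1) • A (z n) + A (N n) +
        (θ n * (w n ^ δ)⁻¹) • ρ n‖ ≤ κ₁ n * ‖z n‖ + ‖A‖ * ‖N n‖ := by
      have n1 : ‖((θ n - 1) / w (n + 1)) • z n‖ = |θ n - 1| / w (n + 1) * ‖z n‖ := by
        rw [norm_smul, norm_div, Real.norm_eq_abs, Real.norm_eq_abs, abs_of_pos hwn]
      have n2 : ‖(θ n - 1) • A (z n)‖ ≤ |θ n - 1| * (‖A‖ * ‖z n‖) := by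
        rw [norm_smul, Real.norm_eq_abs]
        exact mul_le_mul_of_nonneg_left (A.le_opNorm _) (abs_nonneg _)
      have n3 := A.le_opNorm (N n)
      refine (norm_add₄_le).trans ?_
      calc _ ≤ |θ n - 1| / w (n + 1) * ‖z n‖ + |θ n - 1| * (‖A‖ * ‖z n‖) + ‖A‖ * ‖N n‖ +
          (|θ n - 1| + 1) * κ n * ‖z n‖ := by gcongr; exact n1.le
        _ = _ := by simp only [hκ₁]; ring
    have hzy : ‖z n‖ ≤ ‖y n‖ + ‖N n‖ := by
      have : z n = y n + N n := by simp [hy]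
      rw [this]; exact norm_add_le _ _
    have hκz : κ₁ n * ‖z n‖ ≤ c / 4 * ‖y n‖ + κ₁ n * ‖N n‖ := by
      have p1 : 0 ≤ κ₁ n := by have := hκ0 n; positivity
      have p2 := mul_le_mul_of_nonneg_left hzy p1
      have p3 := mul_le_mul_of_nonneg_right h3.le (norm_nonneg (y n))
      linarith
    rw [hrec]
    refine (norm_add_le _ _).trans ?_
    have t1 := norm_add_smul_le_of_dissipative A hA hwn.le h1.le h2.le (y n)
    rw [norm_smul, Real.norm_eq_abs, abs_of_pos hwn]
    have t2 := mul_le_mul_of_nonneg_left (hr.trans (add_le_add_left hκz _)) hwn.le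
    linarith
  have hy0 : Tendsto (fun n => ‖y n‖) atTop (𝓝 0) := by
    refine tendsto_zero_of_contraction (c := c / 4) (by positivity) (fun n => (hw0 (n + 1)).le)
      hw1 hdiv (fun n => norm_nonneg _) ?_ hev
    simpa using (hκ₁0.add_const ‖A‖).mul hN0
  have hz0 : Tendsto z atTop (𝓝 0) := by
    have h1 := tendsto_zero_iff_norm_tendsto_zero.2 hy0
    have h2 := tendsto_zero_iff_norm_tendsto_zero.2 hN0
    simpa [hy] using h1.add h2
  rw [isLittleO_iff]
  intro η hη
  have := (tendsto_zero_iff_norm_tendsto_zero.1 hz0).eventually_lt_const hη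
  filter_upwards [this] with n hn
  rw [hz, norm_smul, norm_inv, Real.norm_eq_abs] at hn
  rw [Real.norm_eq_abs]
  have := abs_pos.2 (hwδ n).ne'
  rw [inv_mul_lt_iff₀ this] at hn
  linarith

/-! ### Convergence of the noise series -/

section Noise

variable {Ω 𝒴 E : Type*} [mΩ : MeasurableSpace Ω] [MeasurableSpace 𝒴] [MeasurableSpace E]

/-- The filtration in which `Y 0, …, Y (n - 1)` are known at time `n`. -/
def pastFiltration (Y : ℕ → Ω → 𝒴) (hY : ∀ n, Measurable (Y n)) : Filtration ℕ mΩ where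
  seq n := ⨆ i ∈ Set.Iio n, MeasurableSpace.comap (Y i) inferInstance
  mono' _ _ h := biSup_mono fun _ hi => lt_of_lt_of_le hi h
  le' _ := iSup₂_le fun i _ => (hY i).comap_le

theorem measurable_pastFiltration {Y : ℕ → Ω → 𝒴} (hY : ∀ n, Measurable (Y n)) {i n : ℕ}
    (hi : i < n) : Measurable[pastFiltration Y hY n] (Y i) := by
  have h : MeasurableSpace.comap (Y i) inferInstance ≤ pastFiltration Y hY n :=
    le_iSup₂_of_le (f := fun i (_ : i ∈ Set.Iio n) => MeasurableSpace.comap (Y i) inferInstance)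
      i hi le_rfl
  exact (comap_measurable (Y i)).mono h le_rfl

theorem indepFun_of_measurable_past {P : Measure Ω} [IsProbabilityMeasure P] {Y : ℕ → Ω → 𝒴}
    (hY : ∀ n, Measurable (Y n)) (hindep : iIndepFun Y P) {n : ℕ} {Z : Ω → E}
    (hZ : Measurable[pastFiltration Y hY n] Z) : IndepFun Z (Y n) P := by
  have h := indep_iSup_of_disjoint (fun i => (hY i).comap_le) hindep.iIndep
    (S := Set.Iio n) (T := {n}) (by simp)
  simp only [Set.mem_singleton_iff, iSup_iSup_eq_left] at h
  exact indep_of_indep_of_le_left h hZ.comap_le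

variable {P : Measure Ω} [IsProbabilityMeasure P] {μ : Measure 𝒴} [IsProbabilityMeasure μ]
  {Y : ℕ → Ω → 𝒴} (hY : ∀ n, Measurable (Y n))

theorem abs_sub_integral_le {g : 𝒴 → ℝ} {C : ℝ} (hC : ∀ y, |g y| ≤ C) (y₀ : 𝒴) :
    |g y₀ - ∫ y, g y ∂μ| ≤ 2 * C := by
  have h1 : ‖∫ y, g y ∂μ‖ ≤ C * μ.real Set.univ :=
    norm_integral_le_of_norm_le_const (ae_of_all _ hC)
  simp only [probReal_univ, mul_one, Real.norm_eq_abs] at h1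
  have h2 := hC y₀
  have := abs_sub (g y₀) (∫ y, g y ∂μ)
  linarith

theorem stronglyMeasurable_noise {X : ℕ → Ω → E}
    (hX : ∀ n, Measurable[pastFiltration Y hY n] (X n)) {g : E → 𝒴 → ℝ}
    (hg : Measurable (Function.uncurry g)) (n : ℕ) :
    StronglyMeasurable[pastFiltration Y hY (n + 1)]
      fun ω => g (X n ω) (Y n ω) - ∫ y, g (X n ω) y ∂μ := by
  have h1 : Measurable[pastFiltration Y hY (n + 1)] (X n) :=
    (hX n).mono ((pastFiltration Y hY).mono n.le_succ) le_rfl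
  have h2 := measurable_pastFiltration hY n.lt_succ_self
  have h3 : Measurable fun x => ∫ y, g x y ∂μ :=
    (hg.stronglyMeasurable.integral_prod_right (ν := μ)).measurable
  exact ((hg.comp (h1.prodMk h2)).sub (h3.comp h1)).stronglyMeasurable

/-- The noise is orthogonal to every bounded function of the past. This gives both the martingale
property of the noise series and its boundedness in `L²`. -/
theorem integral_mul_noise_eq_zero (hlaw : ∀ n, P.map (Y n) = μ) (hindep : iIndepFun Y P)
    {n : ℕ} {X : Ω → E} (hX : Measurable[pastFiltration Y hY n] X) {g : E → 𝒴 → ℝ}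
    (hg : Measurable (Function.uncurry g)) {C : ℝ} (hC : ∀ ω y, |g (X ω) y| ≤ C)
    {V : Ω → ℝ} (hV : Measurable[pastFiltration Y hY n] V) {B : ℝ} (hB : ∀ ω, |V ω| ≤ B) :
    ∫ ω, V ω * (g (X ω) (Y n ω) - ∫ y, g (X ω) y ∂μ) ∂P = 0 := by
  have hX' : Measurable X := hX.mono ((pastFiltration Y hY).le n) le_rfl
  have hV' : Measurable V := hV.mono ((pastFiltration Y hY).le n) le_rfl
  set Z : Ω → ℝ × E := fun ω => (V ω, X ω) with hZ
  have hZm : Measurable[pastFiltration Y hY n] Z := hV.prodMk hX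
  have hZ' : Measurable Z := hV'.prodMk hX'
  set F : (ℝ × E) × 𝒴 → ℝ := fun q => q.1.1 * g q.1.2 q.2 with hF
  have hFm : Measurable F :=
    measurable_fst.fst.mul (hg.comp (measurable_fst.snd.prodMk measurable_snd))
  have hmap := (indepFun_of_measurable_past hY hindep hZm).map_prod_eq_prod_map_map
    hZ'.aemeasurable (hY n).aemeasurable
  rw [hlaw n] at hmap
  have hZY : Measurable fun ω => (Z ω, Y n ω) := hZ'.prodMk (hY n)
  have hint : Integrable (fun ω => F (Z ω, Y n ω)) P := by
    refine Integrable.of_bound (hFm.comp hZY).aestronglyMeasurable (B * C) (ae_of_all _ fun ω => ?_)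
    rw [Real.norm_eq_abs, abs_mul]
    exact mul_le_mul (hB ω) (hC ω _) (abs_nonneg _) ((abs_nonneg _).trans (hB ω))
  have h1 : ∫ ω, F (Z ω, Y n ω) ∂P = ∫ ω, V ω * ∫ y, g (X ω) y ∂μ ∂P := by
    rw [← integral_map (f := F) hZY.aemeasurable hFm.aestronglyMeasurable, hmap, integral_prod,
      integral_map hZ'.aemeasurable]
    · simp only [hF, hZ, integral_const_mul]
    · exact (hFm.stronglyMeasurable.integral_prod_right').aestronglyMeasurable
    · rw [← hmap]
      exact (integrable_map_measure hFm.aestronglyMeasurable hZY.aemeasurable).2 hint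
  have h3 : Measurable fun x => ∫ y, g x y ∂μ :=
    (hg.stronglyMeasurable.integral_prod_right (ν := μ)).measurable
  have hint2 : Integrable (fun ω => V ω * ∫ y, g (X ω) y ∂μ) P := by
    refine Integrable.of_bound (hV'.mul (h3.comp hX')).aestronglyMeasurable (B * C)
      (ae_of_all _ fun ω => ?_)
    have h1 : ‖∫ y, g (X ω) y ∂μ‖ ≤ C * μ.real Set.univ :=
      norm_integral_le_of_norm_le_const (ae_of_all _ fun y => hC ω y)
    simp only [probReal_univ, mul_one] at h1
    rw [norm_mul]
    exact mul_le_mul (hB ω) h1 (norm_nonneg _) ((abs_nonneg _).trans (hB ω))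
  simp only [mul_sub]
  rw [integral_sub hint hint2, h1, sub_self]

/-- Noise built from a bounded function of the past and a fresh observation, with square-summable
weights, has an almost surely convergent series: an `L²`-bounded martingale. -/
theorem ae_tendsto_sum_noise (hlaw : ∀ n, P.map (Y n) = μ) (hindep : iIndepFun Y P)
    {X : ℕ → Ω → E} (hX : ∀ n, Measurable[pastFiltration Y hY n] (X n)) {g : E → 𝒴 → ℝ}
    (hg : Measurable (Function.uncurry g)) {C : ℝ} (hC : ∀ n ω y, |g (X n ω) y| ≤ C)
    {c : ℕ → ℝ} (hc : Summable fun n => c n ^ 2) :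
    ∀ᵐ ω ∂P, ∃ S, Tendsto (fun n => ∑ k ∈ Finset.range n,
      c k * (g (X k ω) (Y k ω) - ∫ y, g (X k ω) y ∂μ)) atTop (𝓝 S) := by
  set d : ℕ → Ω → ℝ := fun k ω => g (X k ω) (Y k ω) - ∫ y, g (X k ω) y ∂μ with hd
  set M : ℕ → Ω → ℝ := fun n ω => ∑ k ∈ Finset.range n, c k * d k ω with hM
  have hdC : ∀ k ω, |d k ω| ≤ 2 * C := fun k ω => abs_sub_integral_le (hC k ω) (Y k ω)
  have hdm : ∀ k, StronglyMeasurable[pastFiltration Y hY (k + 1)] (d k) := fun k =>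
    stronglyMeasurable_noise hY hX hg k
  have hMm : ∀ n, StronglyMeasurable[pastFiltration Y hY n] (M n) := by
    intro n
    refine Finset.stronglyMeasurable_fun_sum _ fun k hk => ?_
    exact ((hdm k).mono ((pastFiltration Y hY).mono (Finset.mem_range.1 hk))).const_mul (c k)
  have hMm' : ∀ n, StronglyMeasurable (M n) := fun n => (hMm n).mono ((pastFiltration Y hY).le n)
  have hdm' : ∀ n, StronglyMeasurable (d n) := fun n => (hdm n).mono ((pastFiltration Y hY).le _)
  have hMB : ∀ n ω, |M n ω| ≤ ∑ k ∈ Finset.range n, |c k| * (2 * C) := by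
    intro n ω
    refine (Finset.abs_sum_le_sum_abs _ _).trans (Finset.sum_le_sum fun k _ => ?_)
    rw [abs_mul]
    exact mul_le_mul_of_nonneg_left (hdC k ω) (abs_nonneg _)
  have hMint : ∀ n, Integrable (M n) P := fun n =>
    Integrable.of_bound (hMm' n).aestronglyMeasurable _ (ae_of_all _ (hMB n))
  have hdint : ∀ n, Integrable (d n) P := fun n =>
    Integrable.of_bound (hdm' n).aestronglyMeasurable _ (ae_of_all _ (hdC n))
  have hsucc : ∀ n, M (n + 1) - M n = fun ω => c n * d n ω := by
    intro n; ext ω; simp [hM, Finset.sum_range_succ]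
  have hmart : Martingale M (pastFiltration Y hY) P := by
    refine martingale_of_condExp_sub_eq_zero_nat hMm hMint fun n => ?_
    rw [hsucc]
    refine (ae_eq_condExp_of_forall_setIntegral_eq ((pastFiltration Y hY).le n)
      ((hdint n).const_mul (c n)) (fun s _ _ => integrableOn_zero) (fun s hs _ => ?_)
      stronglyMeasurable_zero.aestronglyMeasurable).symm
    have h0 := integral_mul_noise_eq_zero hY hlaw hindep (hX n) hg (hC n)
      (V := s.indicator fun _ => c n) (measurable_const.indicator hs) (B := |c n|) (fun ω => by
        by_cases h : ω ∈ s <;> simp [h])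
    refine Eq.trans (by simp) (h0.symm.trans ?_)
    rw [← integral_indicator ((pastFiltration Y hY).le n s hs)]
    congr 1
    ext ω
    by_cases h : ω ∈ s <;> simp [h, hd]
  have hL2 : ∀ n, ∫ ω, M n ω ^ 2 ∂P ≤ ∑ k ∈ Finset.range n, c k ^ 2 * (2 * C) ^ 2 := by
    intro n
    induction n with
    | zero => simp [hM]
    | succ n ih =>
      have e : ∀ ω, M (n + 1) ω ^ 2 = M n ω ^ 2 + 2 * c n * (M n ω * d n ω) +
          c n ^ 2 * d n ω ^ 2 := by
        intro ω; simp only [hM, Finset.sum_range_succ]; ring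
      have o := integral_mul_noise_eq_zero hY hlaw hindep (hX n) hg (hC n)
        (V := M n) (hMm n).measurable (hMB n)
      have i1 : Integrable (fun ω => M n ω ^ 2) P := by
        refine Integrable.of_bound ((hMm' n).pow 2).aestronglyMeasurable
          ((∑ k ∈ Finset.range n, |c k| * (2 * C)) ^ 2) (ae_of_all _ fun ω => ?_)
        rw [norm_pow]; have := hMB n ω; rw [← Real.norm_eq_abs] at this; gcongr
      have i3 : Integrable (fun ω => d n ω ^ 2) P := by
        refine Integrable.of_bound ((hdm' n).pow 2).aestronglyMeasurable
          ((2 * C) ^ 2) (ae_of_all _ fun ω => ?_)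
        rw [norm_pow]; have := hdC n ω; rw [← Real.norm_eq_abs] at this; gcongr
      have i2 : Integrable (fun ω => M n ω * d n ω) P :=
        (hdint n).bdd_mul (hMm' n).aestronglyMeasurable (ae_of_all _ (hMB n))
      have hd2 : ∫ ω, d n ω ^ 2 ∂P ≤ (2 * C) ^ 2 := by
        have : ∫ ω, d n ω ^ 2 ∂P ≤ ∫ _, (2 * C) ^ 2 ∂P := by
          refine integral_mono i3 (integrable_const _) fun ω => ?_
          have := hdC n ω
          rw [← sq_abs]; gcongr
        simpa using this
      have i12 : Integrable (fun ω => M n ω ^ 2 + 2 * c n * (M n ω * d n ω)) P :=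
        i1.add (i2.const_mul _)
      simp only [e]
      rw [integral_add i12 (i3.const_mul _), integral_add i1 (i2.const_mul _),
        integral_const_mul, integral_const_mul, o, Finset.sum_range_succ]
      have := mul_le_mul_of_nonneg_left hd2 (sq_nonneg (c n))
      linarith
  set T : ℝ := (∑' k, c k ^ 2) * (2 * C) ^ 2 with hT
  have hL2' : ∀ n, ∫ ω, M n ω ^ 2 ∂P ≤ T := fun n => by
    refine (hL2 n).trans ?_
    rw [← Finset.sum_mul]
    exact mul_le_mul_of_nonneg_right (hc.sum_le_tsum _ fun _ _ => sq_nonneg _) (sq_nonneg _)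
  have hL1 : ∀ n, eLpNorm (M n) 1 P ≤ ((1 + T).toNNReal : ENNReal) := by
    intro n
    rw [eLpNorm_one_eq_lintegral_enorm, ← ofReal_integral_norm_eq_lintegral_enorm (hMint n)]
    refine ENNReal.ofReal_le_ofReal ?_
    have i1 : Integrable (fun ω => M n ω ^ 2) P := by
      refine Integrable.of_bound ((hMm' n).pow 2).aestronglyMeasurable
        ((∑ k ∈ Finset.range n, |c k| * (2 * C)) ^ 2) (ae_of_all _ fun ω => ?_)
      rw [norm_pow]; have := hMB n ω; rw [← Real.norm_eq_abs] at this; gcongr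
    have : ∫ ω, ‖M n ω‖ ∂P ≤ ∫ ω, (1 + M n ω ^ 2) ∂P := by
      refine integral_mono (hMint n).norm ((integrable_const _).add i1) fun ω => ?_
      simp only [Real.norm_eq_abs]
      nlinarith [sq_abs (M n ω), sq_nonneg (|M n ω| - 1), abs_nonneg (M n ω)]
    rw [integral_add (integrable_const _) i1] at this
    have h2 := hL2' n
    simp only [integral_const, probReal_univ, smul_eq_mul, mul_one] at this
    linarith
  exact hmart.submartingale.exists_ae_tendsto_of_bdd hL1

end Noise

/-! ### Ratios of mixtures -/

section Mixture

variable {𝒴 U : Type*} [Fintype U]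

/-- The standing assumptions on the kernel `p`, the distribution `μ` of an observation and an
interior point `fs` of the simplex. Pointwise positivity of the kernel holds `μ`-almost everywhere
only. -/
structure IsRegular [MeasurableSpace 𝒴] (μ : Measure 𝒴) (p : 𝒴 → U → ℝ) (fs : U → ℝ) : Prop where
  measurable : ∀ u, Measurable fun y => p y u
  nonneg : ∀ y u, 0 ≤ p y u
  ae_pos : ∀ᵐ y ∂μ, ∀ u, 0 < p y u
  mem : fs ∈ stdSimplex ℝ U
  pos : ∀ u, 0 < fs u

theorem mixture_add (p : 𝒴 → U → ℝ) (f g : U → ℝ) (y : 𝒴) :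
    mixture p (f + g) y = mixture p f y + mixture p g y := by
  simp [mixture, mul_add, Finset.sum_add_distrib]

theorem mixture_sub (p : 𝒴 → U → ℝ) (f g : U → ℝ) (y : 𝒴) :
    mixture p (f - g) y = mixture p f y - mixture p g y := by
  simp [mixture, mul_sub, Finset.sum_sub_distrib]

theorem mixture_smul (p : 𝒴 → U → ℝ) (t : ℝ) (f : U → ℝ) (y : 𝒴) :
    mixture p (t • f) y = t * mixture p f y := by
  simp only [mixture, Finset.mul_sum, Pi.smul_apply, smul_eq_mul]
  exact Finset.sum_congr rfl fun u _ => by ring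

theorem continuous_mixture (p : 𝒴 → U → ℝ) (y : 𝒴) : Continuous fun f => mixture p f y := by
  unfold mixture; fun_prop

theorem measurable_mixture_uncurry [MeasurableSpace 𝒴] {p : 𝒴 → U → ℝ}
    (hp : ∀ u, Measurable fun y => p y u) :
    Measurable fun q : (U → ℝ) × 𝒴 => mixture p q.1 q.2 := by
  unfold mixture
  exact Finset.measurable_fun_sum _ fun u _ =>
    ((hp u).comp measurable_snd).mul ((measurable_pi_apply u).comp measurable_fst)

theorem measurable_mixture [MeasurableSpace 𝒴] {p : 𝒴 → U → ℝ}
    (hp : ∀ u, Measurable fun y => p y u) (f : U → ℝ) :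
    Measurable (mixture p f) :=
  (measurable_mixture_uncurry hp).comp (measurable_const.prodMk measurable_id)

theorem mixture_nonneg {p : 𝒴 → U → ℝ} {y : 𝒴} (hp : ∀ u, 0 ≤ p y u) {f : U → ℝ}
    (hf : ∀ u, 0 ≤ f u) : 0 ≤ mixture p f y :=
  Finset.sum_nonneg fun u _ => mul_nonneg (hp u) (hf u)

theorem mixture_pos {p : 𝒴 → U → ℝ} {y : 𝒴} (hp : ∀ u, 0 < p y u) {f : U → ℝ}
    (hf : f ∈ stdSimplex ℝ U) : 0 < mixture p f y := by
  refine lt_of_le_of_ne (mixture_nonneg (fun u => (hp u).le) hf.1) fun h => ?_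
  have h0 := (Finset.sum_eq_zero_iff_of_nonneg
    (fun u _ => mul_nonneg (hp u).le (hf.1 u))).1 h.symm
  have : ∑ u, f u = 0 := Finset.sum_eq_zero fun u hu =>
    (mul_eq_zero.1 (h0 u hu)).resolve_left (hp u).ne'
  rw [hf.2] at this
  exact one_ne_zero this

theorem mul_le_mixture {p : 𝒴 → U → ℝ} {y : 𝒴} (hp : ∀ u, 0 ≤ p y u) {f : U → ℝ}
    (hf : ∀ u, 0 ≤ f u) (u : U) : p y u * f u ≤ mixture p f y :=
  Finset.single_le_sum (f := fun u => p y u * f u) (fun u _ => mul_nonneg (hp u) (hf u))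
    (Finset.mem_univ u)

theorem mul_div_mixture_le_one {p : 𝒴 → U → ℝ} {y : 𝒴} (hp : ∀ u, 0 ≤ p y u) {f : U → ℝ}
    (hf : ∀ u, 0 ≤ f u) (u : U) : p y u * f u / mixture p f y ≤ 1 :=
  div_le_one_of_le₀ (mul_le_mixture hp hf u) (mixture_nonneg hp hf)

theorem div_mixture_le_inv {p : 𝒴 → U → ℝ} {y : 𝒴} (hp : ∀ u, 0 ≤ p y u) {f : U → ℝ}
    (hf : ∀ u, 0 ≤ f u) {u : U} (hu : 0 < f u) : p y u / mixture p f y ≤ (f u)⁻¹ := by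
  have h := mul_div_mixture_le_one hp hf u
  rw [← one_div, le_div_iff₀ hu]
  rwa [div_mul_eq_mul_div]

theorem sum_mul_div_mixture (p : 𝒴 → U → ℝ) (f g : U → ℝ) (y : 𝒴) :
    ∑ u, g u * (p y u / mixture p f y) = mixture p g y / mixture p f y := by
  rw [show mixture p g y = ∑ u, p y u * g u from rfl, Finset.sum_div]
  exact Finset.sum_congr rfl fun u _ => by ring

theorem abs_mixture_div_le {p : 𝒴 → U → ℝ} {y : 𝒴} (hp : ∀ u, 0 ≤ p y u) {fs : U → ℝ}
    (hfs : ∀ u, 0 < fs u) (d : U → ℝ) :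
    |mixture p d y / mixture p fs y| ≤ ∑ u, |d u| / fs u := by
  rw [← sum_mul_div_mixture]
  refine (Finset.abs_sum_le_sum_abs _ _).trans (Finset.sum_le_sum fun u _ => ?_)
  have h0 : 0 ≤ p y u / mixture p fs y := div_nonneg (hp u) (mixture_nonneg hp fun u => (hfs u).le)
  rw [abs_mul, abs_of_nonneg h0, div_eq_mul_inv]
  exact mul_le_mul_of_nonneg_left (div_mixture_le_inv hp (fun u => (hfs u).le) (hfs u))
    (abs_nonneg _)

variable [MeasurableSpace 𝒴] {μ : Measure 𝒴} [IsProbabilityMeasure μ] {p : 𝒴 → U → ℝ} {fs : U → ℝ}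

theorem IsRegular.integrable_div (h : IsRegular μ p fs) {f : U → ℝ} (hf : ∀ u, 0 ≤ f u) {u : U}
    (hu : 0 < f u) : Integrable (fun y => p y u / mixture p f y) μ := by
  refine Integrable.of_bound
    ((h.measurable u).div (measurable_mixture h.measurable f)).aestronglyMeasurable (f u)⁻¹
    (ae_of_all _ fun y => ?_)
  rw [Real.norm_eq_abs, abs_of_nonneg (div_nonneg (h.nonneg y u) (mixture_nonneg (h.nonneg y) hf))]
  exact div_mixture_le_inv (h.nonneg y) hf hu

theorem IsRegular.integrable_mixture_div (h : IsRegular μ p fs) {f : U → ℝ} (hf : ∀ u, 0 < f u)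
    (d : U → ℝ) : Integrable (fun y => mixture p d y / mixture p f y) μ := by
  simp only [← sum_mul_div_mixture]
  exact integrable_finsetSum _ fun u _ =>
    (h.integrable_div (fun u => (hf u).le) (hf u)).const_mul _

theorem IsRegular.integral_mixture_div (h : IsRegular μ p fs) {f : U → ℝ} (hf : ∀ u, 0 < f u)
    (d : U → ℝ) : ∫ y, mixture p d y / mixture p f y ∂μ =
      ∑ u, d u * ∫ y, p y u / mixture p f y ∂μ := by
  simp only [← sum_mul_div_mixture]
  rw [integral_finsetSum _ fun u _ =>
    (h.integrable_div (fun u => (hf u).le) (hf u)).const_mul _]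
  simp only [integral_const_mul]

theorem sub_two_mul_sq_le_log {s : ℝ} (hs : |s| ≤ 1 / 2) : s - 2 * s ^ 2 ≤ Real.log (1 + s) := by
  obtain ⟨h1, h2⟩ := abs_le.1 hs
  have hp : 0 < 1 + s := by linarith
  have h3 := Real.one_sub_inv_le_log_of_pos hp
  refine le_trans ?_ h3
  have : 1 - (1 + s)⁻¹ = s / (1 + s) := by field_simp; ring
  rw [this, le_div_iff₀ hp]
  nlinarith [mul_nonneg (sq_nonneg s) (by linarith : 0 ≤ 1 + 2 * s)]

/-- Second-order lower bound for the expected log-likelihood ratio near an interior point. -/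
theorem IsRegular.le_integral_log (h : IsRegular μ p fs) {f : U → ℝ}
    (hβ : ∑ u, |f u - fs u| / fs u ≤ 1 / 2) :
    ∑ u, (f u - fs u) * ∫ y, p y u / mixture p fs y ∂μ - 2 * (∑ u, |f u - fs u| / fs u) ^ 2 ≤
      ∫ y, Real.log (mixture p f y / mixture p fs y) ∂μ := by
  set β := ∑ u, |f u - fs u| / fs u with hβ'
  set s : 𝒴 → ℝ := fun y => mixture p (f - fs) y / mixture p fs y with hs
  have hsβ : ∀ y, |s y| ≤ β := fun y => by
    simpa using abs_mixture_div_le (h.nonneg y) h.pos (f - fs)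
  have hs1 : ∀ᵐ y ∂μ, mixture p f y / mixture p fs y = 1 + s y := by
    filter_upwards [h.ae_pos] with y hy
    have := (mixture_pos hy h.mem).ne'
    simp only [hs, mixture_sub]
    field_simp; ring
  have hsint : Integrable s μ := h.integrable_mixture_div h.pos _
  have e1 : ∫ y, s y ∂μ = ∑ u, (f u - fs u) * ∫ y, p y u / mixture p fs y ∂μ := by
    simpa using h.integral_mixture_div h.pos (f - fs)
  have hlow : ∀ᵐ y ∂μ, s y - 2 * β ^ 2 ≤ Real.log (mixture p f y / mixture p fs y) := by
    filter_upwards [hs1] with y hy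
    rw [hy]
    have := sub_two_mul_sq_le_log ((hsβ y).trans hβ)
    have h2 : s y ^ 2 ≤ β ^ 2 := by
      rw [← sq_abs]; have := hsβ y; gcongr
    linarith
  have hlogint : Integrable (fun y => Real.log (mixture p f y / mixture p fs y)) μ := by
    refine Integrable.of_bound ((measurable_mixture h.measurable f).div
      (measurable_mixture h.measurable fs)).log.aestronglyMeasurable (β + 2 * β ^ 2) ?_
    filter_upwards [hlow, hs1] with y h1 h2
    have h3 := abs_le.1 (hsβ y)
    rw [Real.norm_eq_abs, abs_le]
    constructor
    · linarith
    · rw [h2]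
      have h4 := abs_le.1 ((hsβ y).trans hβ)
      have := Real.log_le_sub_one_of_pos (by linarith : 0 < 1 + s y)
      have := sq_nonneg β
      linarith
  rw [← e1]
  calc ∫ y, s y ∂μ - 2 * β ^ 2 = ∫ y, (s y - 2 * β ^ 2) ∂μ := by
        rw [integral_sub hsint (integrable_const _)]; simp
    _ ≤ _ := integral_mono_ae (hsint.sub (integrable_const _)) hlogint hlow

theorem eq_zero_of_forall_mul_le {a τ K : ℝ} (hτ : 0 < τ) (hK : 0 ≤ K)
    (h : ∀ t, |t| ≤ τ → t * a ≤ t ^ 2 * K) : a = 0 := by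
  by_contra ha
  have ha' : 0 < |a| := abs_pos.2 ha
  set k := min (τ / |a|) (1 / (2 * (K + 1))) with hk
  have hk0 : 0 < k := by positivity
  have h1 : |a * k| ≤ τ := by
    rw [abs_mul, abs_of_pos hk0]
    calc |a| * k ≤ |a| * (τ / |a|) := by gcongr; exact min_le_left _ _
      _ = τ := by field_simp
  have h2 := h _ h1
  have h3 : k * K < 1 := by
    have : k * (2 * (K + 1)) ≤ 1 := by
      rw [← le_div_iff₀ (by positivity)]; exact min_le_right _ _
    nlinarith
  have h4 : 0 < a ^ 2 * k := by positivity
  nlinarith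

/-- First-order optimality: if `fs` is an interior maximizer of the expected log-likelihood then
every likelihood ratio `p(· ∣ u) / m_fs` has mean one. -/
theorem IsRegular.integral_div_eq_one (h : IsRegular μ p fs)
    (hmax : ∀ f ∈ stdSimplex ℝ U, ∫ y, Real.log (mixture p f y / mixture p fs y) ∂μ ≤ 0) (v : U) :
    ∫ y, p y v / mixture p fs y ∂μ = 1 := by
  classical
  set R : U → ℝ := fun u => ∫ y, p y u / mixture p fs y ∂μ with hR
  have hsum : ∑ u, fs u * R u = 1 := by
    rw [← h.integral_mixture_div h.pos fs]
    have : ∀ᵐ y ∂μ, mixture p fs y / mixture p fs y = 1 := by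
      filter_upwards [h.ae_pos] with y hy using div_self (mixture_pos hy h.mem).ne'
    rw [integral_congr_ae this]; simp
  set e : U → ℝ := Pi.single v 1 - fs with he
  set b := ∑ u, |e u| / fs u with hb
  have hb0 : 0 ≤ b := Finset.sum_nonneg fun u _ => div_nonneg (abs_nonneg _) (h.pos u).le
  suffices R v - 1 = 0 by linarith
  refine eq_zero_of_forall_mul_le (τ := min (fs v) (1 / (2 * (b + 1)))) (K := 2 * b ^ 2)
    (lt_min (h.pos v) (by positivity)) (by positivity) fun t ht => ?_
  have ht1 : |t| ≤ fs v := ht.trans (min_le_left _ _)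
  have ht2 : |t| * b ≤ 1 / 2 := by
    have : |t| * (2 * (b + 1)) ≤ 1 := by
      rw [← le_div_iff₀ (by positivity)]; exact ht.trans (min_le_right _ _)
    nlinarith [abs_nonneg t]
  have hfv1 : ∀ u, fs u ≤ 1 := fun u => by
    rw [← h.mem.2]; exact Finset.single_le_sum (fun u _ => h.mem.1 u) (Finset.mem_univ u)
  have hmem : fs + t • e ∈ stdSimplex ℝ U := by
    refine ⟨fun u => ?_, ?_⟩
    · by_cases huv : u = v
      · subst huv
        have := abs_le.1 ht1
        have h1 := hfv1 u
        have h2 := h.pos u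
        simp only [he, Pi.add_apply, Pi.smul_apply, Pi.sub_apply, Pi.single_eq_same, smul_eq_mul]
        nlinarith
      · have := abs_le.1 (ht1.trans (hfv1 v))
        have h2 := h.pos u
        simp only [he, Pi.add_apply, Pi.smul_apply, Pi.sub_apply, Pi.single_eq_of_ne huv,
          smul_eq_mul]
        nlinarith
    · simp only [he, Pi.add_apply, Pi.smul_apply, Pi.sub_apply, smul_eq_mul,
        Finset.sum_add_distrib, ← Finset.mul_sum, Finset.sum_sub_distrib, h.mem.2]
      simp
  have hdiff : ∀ u, (fs + t • e) u - fs u = t * e u := fun u => by simp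
  have hβ : ∑ u, |(fs + t • e) u - fs u| / fs u = |t| * b := by
    rw [hb, Finset.mul_sum]
    exact Finset.sum_congr rfl fun u _ => by rw [hdiff, abs_mul, mul_div_assoc]
  have key := (h.le_integral_log (hβ.trans_le ht2)).trans (hmax _ hmem)
  rw [hβ, mul_pow, sq_abs] at key
  have : ∑ u, ((fs + t • e) u - fs u) * R u = t * (R v - 1) := by
    simp only [hdiff, mul_assoc, ← Finset.mul_sum]
    congr 1
    simp only [he, Pi.sub_apply, sub_mul, Finset.sum_sub_distrib, hsum]
    simp [Pi.single_apply]
  rw [this] at key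
  linarith

end Mixture

/-! ### The truncated drift of the Lyapunov function -/

section Drift

variable {𝒴 U : Type*} [Fintype U]

/-- The mean likelihood ratio `∑ u, fs u * (p(y ∣ u) / m_f(y))` with every ratio cut off at `M`. -/
noncomputable def truncRatio (p : 𝒴 → U → ℝ) (fs : U → ℝ) (M : ℝ) (f : U → ℝ) (y : 𝒴) : ℝ :=
  ∑ u, fs u * min (p y u / mixture p f y) M

/-- To first order in the weight, the expected decrease per unit of weight of the Kullback-Leibler
divergence of `f` from `fs` in one step of the recursion started at `f`, the likelihood ratios being
cut off at `M`. -/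
noncomputable def truncDrift [MeasurableSpace 𝒴] (μ : Measure 𝒴) (p : 𝒴 → U → ℝ) (fs : U → ℝ)
    (M : ℝ) (f : U → ℝ) : ℝ :=
  ∫ y, truncRatio p fs M f y ∂μ - 1

theorem truncRatio_nonneg {p : 𝒴 → U → ℝ} {y : 𝒴} (hp : ∀ u, 0 ≤ p y u) {fs f : U → ℝ}
    (hfs : ∀ u, 0 ≤ fs u) {M : ℝ} (hM : 0 ≤ M) (hf : ∀ u, 0 ≤ f u) :
    0 ≤ truncRatio p fs M f y :=
  Finset.sum_nonneg fun u _ =>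
    mul_nonneg (hfs u) (le_min (div_nonneg (hp u) (mixture_nonneg hp hf)) hM)

theorem truncRatio_le {p : 𝒴 → U → ℝ} {fs f : U → ℝ} (hfs : fs ∈ stdSimplex ℝ U) {M : ℝ} {y : 𝒴} :
    truncRatio p fs M f y ≤ M := by
  calc truncRatio p fs M f y ≤ ∑ u, fs u * M :=
        Finset.sum_le_sum fun u _ => mul_le_mul_of_nonneg_left (min_le_right _ _) (hfs.1 u)
    _ = M := by rw [← Finset.sum_mul, hfs.2, one_mul]

theorem abs_truncRatio_le {p : 𝒴 → U → ℝ} {y : 𝒴} (hp : ∀ u, 0 ≤ p y u) {fs f : U → ℝ}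
    (hfs : fs ∈ stdSimplex ℝ U) {M : ℝ} (hM : 0 ≤ M) (hf : ∀ u, 0 ≤ f u) :
    |truncRatio p fs M f y| ≤ M := by
  rw [abs_of_nonneg (truncRatio_nonneg hp hfs.1 hM hf)]
  exact truncRatio_le hfs

theorem truncRatio_mono {p : 𝒴 → U → ℝ} {fs f : U → ℝ} (hfs : ∀ u, 0 ≤ fs u) {M M' : ℝ}
    (h : M ≤ M') (y : 𝒴) : truncRatio p fs M f y ≤ truncRatio p fs M' f y :=
  Finset.sum_le_sum fun u _ => mul_le_mul_of_nonneg_left (min_le_min_left _ h) (hfs u)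

/-- The truncation has no effect at points whose coordinates are at least `1 / M`. -/
theorem truncRatio_eq {p : 𝒴 → U → ℝ} {y : 𝒴} (hp : ∀ u, 0 ≤ p y u) {fs f : U → ℝ} {M : ℝ}
    (hf : ∀ u, 0 < f u) (hM : ∀ u, (f u)⁻¹ ≤ M) :
    truncRatio p fs M f y = mixture p fs y / mixture p f y := by
  rw [← sum_mul_div_mixture]
  refine Finset.sum_congr rfl fun u _ => ?_
  rw [min_eq_left ((div_mixture_le_inv hp (fun u => (hf u).le) (hf u)).trans (hM u))]

theorem tendsto_truncRatio (p : 𝒴 → U → ℝ) (fs f : U → ℝ) (y : 𝒴) :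
    Tendsto (fun k : ℕ => truncRatio p fs k f y) atTop
      (𝓝 (mixture p fs y / mixture p f y)) := by
  rw [← sum_mul_div_mixture]
  refine tendsto_finsetSum _ fun u _ => Tendsto.const_mul _ ?_
  refine tendsto_const_nhds.congr' ?_
  filter_upwards [eventually_ge_atTop ⌈p y u / mixture p f y⌉₊] with k hk
  exact (min_eq_left (Nat.ceil_le.1 hk)).symm

variable [MeasurableSpace 𝒴]

theorem measurable_truncRatio_uncurry {p : 𝒴 → U → ℝ} (hp : ∀ u, Measurable fun y => p y u)
    (fs : U → ℝ) (M : ℝ) : Measurable (Function.uncurry (truncRatio p fs M)) := by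
  unfold truncRatio Function.uncurry
  exact Finset.measurable_fun_sum _ fun u _ =>
    ((((hp u).comp measurable_snd).div (measurable_mixture_uncurry hp)).min
      measurable_const).const_mul _

theorem measurable_truncRatio {p : 𝒴 → U → ℝ} (hp : ∀ u, Measurable fun y => p y u)
    (fs : U → ℝ) (M : ℝ) (f : U → ℝ) : Measurable (truncRatio p fs M f) :=
  (measurable_truncRatio_uncurry hp fs M).comp (measurable_const.prodMk measurable_id)

variable {μ : Measure 𝒴} [IsProbabilityMeasure μ] {p : 𝒴 → U → ℝ} {fs : U → ℝ}

theorem IsRegular.integrable_truncRatio (h : IsRegular μ p fs) {M : ℝ} (hM : 0 ≤ M) {f : U → ℝ}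
    (hf : ∀ u, 0 ≤ f u) : Integrable (truncRatio p fs M f) μ :=
  Integrable.of_bound (measurable_truncRatio h.measurable fs M f).aestronglyMeasurable M
    (ae_of_all _ fun y => abs_truncRatio_le (h.nonneg y) h.mem hM hf)

theorem IsRegular.truncDrift_mono (h : IsRegular μ p fs) {M M' : ℝ} (hM : 0 ≤ M) (hM' : M ≤ M')
    {f : U → ℝ} (hf : ∀ u, 0 ≤ f u) : truncDrift μ p fs M f ≤ truncDrift μ p fs M' f :=
  sub_le_sub_right (integral_mono (h.integrable_truncRatio hM hf)
    (h.integrable_truncRatio (hM.trans hM') hf) (truncRatio_mono h.mem.1 hM')) 1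

/-- Continuity holds up to the boundary of the simplex because the truncation makes the integrand
bounded. -/
theorem IsRegular.continuousOn_truncDrift (h : IsRegular μ p fs) {M : ℝ} (hM : 0 ≤ M) :
    ContinuousOn (truncDrift μ p fs M) (stdSimplex ℝ U) := by
  refine ContinuousOn.sub ?_ continuousOn_const
  refine continuousOn_of_dominated (bound := fun _ => M)
    (fun f _ => (measurable_truncRatio h.measurable fs M f).aestronglyMeasurable)
    (fun f hf => ae_of_all _ fun y => abs_truncRatio_le (h.nonneg y) h.mem hM hf.1)
    (integrable_const _) ?_
  filter_upwards [h.ae_pos] with y hy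
  refine continuousOn_finsetSum _ fun u _ => ContinuousOn.mul continuousOn_const ?_
  refine ContinuousOn.inf ?_ continuousOn_const
  exact continuousOn_const.div (continuous_mixture p y).continuousOn
    fun f hf => (mixture_pos hy hf).ne'

/-- The mean of `t = m_fs / m_f` exceeds one, since `t + 1 / t ≥ 2` and `1 / t` has mean one. -/
theorem IsRegular.one_lt_integral_mixture_div (h : IsRegular μ p fs)
    (hR : ∀ u, ∫ y, p y u / mixture p fs y ∂μ = 1) (hident : Identifiable μ p)
    {f : U → ℝ} (hf : f ∈ stdSimplex ℝ U) (hne : f ≠ fs)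
    (hint : Integrable (fun y => mixture p fs y / mixture p f y) μ) :
    1 < ∫ y, mixture p fs y / mixture p f y ∂μ := by
  by_contra hcon
  rw [not_lt] at hcon
  have hint' : Integrable (fun y => mixture p f y / mixture p fs y) μ :=
    h.integrable_mixture_div h.pos f
  have h1 : ∫ y, mixture p f y / mixture p fs y ∂μ = 1 := by
    rw [h.integral_mixture_div h.pos f]; simp [hR, hf.2]
  set φ : 𝒴 → ℝ := fun y =>
    mixture p fs y / mixture p f y + mixture p f y / mixture p fs y - 2 with hφ
  have hφe : ∀ᵐ y ∂μ, φ y =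
      (mixture p fs y - mixture p f y) ^ 2 / (mixture p f y * mixture p fs y) := by
    filter_upwards [h.ae_pos] with y hy
    have a := (mixture_pos hy h.mem).ne'
    have b := (mixture_pos hy hf).ne'
    simp only [hφ]; field_simp; ring
  have hφ0 : 0 ≤ᵐ[μ] φ := by
    filter_upwards [hφe] with y hy
    rw [hy, Pi.zero_apply]
    exact div_nonneg (sq_nonneg _) (mul_nonneg (mixture_nonneg (h.nonneg y) hf.1)
      (mixture_nonneg (h.nonneg y) h.mem.1))
  have hφi : Integrable φ μ := (hint.add hint').sub (integrable_const _)
  have hle : ∫ y, φ y ∂μ ≤ 0 := by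
    have : ∫ y, φ y ∂μ = ∫ y, mixture p fs y / mixture p f y ∂μ +
        ∫ y, mixture p f y / mixture p fs y ∂μ - 2 := by
      have hadd : Integrable (fun y => mixture p fs y / mixture p f y +
          mixture p f y / mixture p fs y) μ := hint.add hint'
      simp only [hφ]
      rw [integral_sub hadd (integrable_const _), integral_add hint hint']
      simp
    rw [this, h1]; linarith
  have hzero := (integral_eq_zero_iff_of_nonneg_ae hφ0 hφi).1
    (le_antisymm hle (integral_nonneg_of_ae hφ0))
  refine hne (hident f hf fs h.mem ?_)
  filter_upwards [hzero, hφe, h.ae_pos] with y h0 he hy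
  have a := mixture_pos hy h.mem
  have b := mixture_pos hy hf
  rw [h0, Pi.zero_apply, eq_comm, div_eq_zero_iff] at he
  rcases he with he | he
  · have := pow_eq_zero_iff (two_ne_zero) |>.1 he; linarith
  · exact absurd he (mul_pos b a).ne'

theorem IsRegular.exists_truncDrift_pos (h : IsRegular μ p fs)
    (hR : ∀ u, ∫ y, p y u / mixture p fs y ∂μ = 1) (hident : Identifiable μ p)
    {f : U → ℝ} (hf : f ∈ stdSimplex ℝ U) (hne : f ≠ fs) :
    ∃ k : ℕ, 0 < truncDrift μ p fs k f := by
  by_contra! hcon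
  have hti : ∀ k : ℕ, Integrable (truncRatio p fs k f) μ := fun k =>
    h.integrable_truncRatio k.cast_nonneg hf.1
  have ht0 : ∀ k : ℕ, 0 ≤ᵐ[μ] truncRatio p fs k f := fun k =>
    ae_of_all _ fun y => truncRatio_nonneg (h.nonneg y) h.mem.1 k.cast_nonneg hf.1
  have hle : ∀ k : ℕ, ∫⁻ y, ENNReal.ofReal (truncRatio p fs k f y) ∂μ ≤ 1 := fun k => by
    rw [← ofReal_integral_eq_lintegral_ofReal (hti k) (ht0 k), ENNReal.ofReal_le_one]
    have := hcon k
    simp only [truncDrift] at this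
    linarith
  have hlim := lintegral_tendsto_of_tendsto_of_monotone (μ := μ)
    (f := fun (k : ℕ) y => ENNReal.ofReal (truncRatio p fs k f y))
    (F := fun y => ENNReal.ofReal (mixture p fs y / mixture p f y))
    (fun k => (measurable_truncRatio h.measurable fs k f).ennreal_ofReal.aemeasurable)
    (ae_of_all _ fun y i j hij => ENNReal.ofReal_le_ofReal
      (truncRatio_mono h.mem.1 (Nat.cast_le.2 hij) y))
    (ae_of_all _ fun y => ENNReal.tendsto_ofReal (tendsto_truncRatio p fs f y))
  have hle1 := le_of_tendsto' hlim hle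
  have hnn : 0 ≤ᵐ[μ] fun y => mixture p fs y / mixture p f y := ae_of_all _ fun y =>
    div_nonneg (mixture_nonneg (h.nonneg y) h.mem.1) (mixture_nonneg (h.nonneg y) hf.1)
  have hm : Measurable fun y => mixture p fs y / mixture p f y :=
    (measurable_mixture h.measurable fs).div (measurable_mixture h.measurable f)
  have hint : Integrable (fun y => mixture p fs y / mixture p f y) μ :=
    (lintegral_ofReal_ne_top_iff_integrable hm.aestronglyMeasurable hnn).1
      (hle1.trans_lt ENNReal.one_lt_top).ne
  have := h.one_lt_integral_mixture_div hR hident hf hne hint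
  rw [← ofReal_integral_eq_lintegral_ofReal hint hnn, ENNReal.ofReal_le_one] at hle1
  linarith

/-- One truncation level works for the whole simplex: away from `fs` by compactness, and near `fs`
because there the likelihood ratios are bounded and the truncation has no effect. -/
theorem IsRegular.exists_truncation (h : IsRegular μ p fs)
    (hR : ∀ u, ∫ y, p y u / mixture p fs y ∂μ = 1) (hident : Identifiable μ p) :
    ∃ M : ℝ, 1 ≤ M ∧ truncDrift μ p fs M fs = 0 ∧
      ∀ f ∈ stdSimplex ℝ U, f ≠ fs → 0 < truncDrift μ p fs M f := by
  set M₀ : ℝ := ∑ u, 2 / fs u with hM₀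
  have hM₀u : ∀ u, 2 / fs u ≤ M₀ := fun u =>
    Finset.single_le_sum (f := fun u => 2 / fs u) (fun u _ => div_nonneg two_pos.le (h.pos u).le)
      (Finset.mem_univ u)
  have hM₀0 : 0 ≤ M₀ := Finset.sum_nonneg fun u _ => div_nonneg two_pos.le (h.pos u).le
  have hnear : ∀ f ∈ stdSimplex ℝ U, (∀ u, fs u / 2 < f u) → ∀ M, M₀ ≤ M →
      Integrable (fun y => mixture p fs y / mixture p f y) μ ∧
      truncDrift μ p fs M f = ∫ y, mixture p fs y / mixture p f y ∂μ - 1 := by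
    intro f hf hfu M hM
    have hf0 : ∀ u, 0 < f u := fun u => (half_pos (h.pos u)).trans (hfu u)
    refine ⟨h.integrable_mixture_div hf0 fs, ?_⟩
    rw [truncDrift]
    congr 1
    refine integral_congr_ae (ae_of_all _ fun y => truncRatio_eq (h.nonneg y) hf0 fun u => ?_)
    refine le_trans ?_ ((hM₀u u).trans hM)
    rw [← inv_div]
    exact inv_anti₀ (half_pos (h.pos u)) (hfu u).le
  have hcompact : ∃ M₁ : ℝ, ∀ M, M₁ ≤ M → ∀ f ∈ stdSimplex ℝ U, f ≠ fs →
      0 < truncDrift μ p fs M f := by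
    have := (isCompact_stdSimplex ℝ U).induction_on
      (p := fun s => ∃ M₁ : ℝ, ∀ M, M₁ ≤ M → ∀ f ∈ s, f ∈ stdSimplex ℝ U → f ≠ fs →
        0 < truncDrift μ p fs M f) ⟨0, by simp⟩
      (fun s t hst ⟨M, hM⟩ => ⟨M, fun M' h' f hf => hM M' h' f (hst hf)⟩)
      (fun s t ⟨M, hM⟩ ⟨M', hM'⟩ => ⟨max M M', fun N hN f hf => hf.elim
        (hM N ((le_max_left _ _).trans hN) f) (hM' N ((le_max_right _ _).trans hN) f)⟩) ?_
    · obtain ⟨M₁, hM₁⟩ := this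
      exact ⟨M₁, fun M hM f hf => hM₁ M hM f hf hf⟩
    intro g hg
    by_cases hgs : g = fs
    · subst hgs
      refine ⟨{f | ∀ u, g u / 2 < f u}, mem_nhdsWithin_of_mem_nhds ?_, M₀, ?_⟩
      · have : ∀ u, ∀ᶠ f : U → ℝ in 𝓝 g, g u / 2 < f u := fun u =>
          (continuous_apply u).continuousAt.eventually_const_lt (half_lt_self (h.pos u))
        exact eventually_all.2 this
      · intro M hM f hfu hf hne
        obtain ⟨hint, he⟩ := hnear f hf hfu M hM
        have := h.one_lt_integral_mixture_div hR hident hf hne hint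
        rw [he]; linarith
    · obtain ⟨k, hk⟩ := h.exists_truncDrift_pos hR hident hg hgs
      have hc := (h.continuousOn_truncDrift k.cast_nonneg g hg).eventually_const_lt hk
      refine ⟨_, inter_mem hc self_mem_nhdsWithin, k, ?_⟩
      intro M hM f hf _ _
      exact lt_of_lt_of_le hf.1 (h.truncDrift_mono k.cast_nonneg hM hf.2.1)
  obtain ⟨M₁, hM₁⟩ := hcompact
  refine ⟨max 1 (max M₀ M₁), le_max_left _ _, ?_,
    hM₁ _ ((le_max_right _ _).trans (le_max_right _ _))⟩
  rw [(hnear fs h.mem (fun u => half_lt_self (h.pos u)) _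
    ((le_max_left _ _).trans (le_max_right _ _))).2]
  have : ∀ᵐ y ∂μ, mixture p fs y / mixture p fs y = 1 := by
    filter_upwards [h.ae_pos] with y hy using div_self (mixture_pos hy h.mem).ne'
  rw [integral_congr_ae this]; simp

theorem IsRegular.exists_truncDrift_lt (h : IsRegular μ p fs) {M : ℝ} (hM : 0 ≤ M)
    (hpos : ∀ f ∈ stdSimplex ℝ U, f ≠ fs → 0 < truncDrift μ p fs M f) {V : Set (U → ℝ)}
    (hV : V ∈ 𝓝 fs) : ∃ ε > 0, ∀ f ∈ stdSimplex ℝ U, truncDrift μ p fs M f < ε → f ∈ V := by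
  obtain ⟨W, hWV, hWo, hW⟩ := mem_nhds_iff.1 hV
  have hK : IsCompact (stdSimplex ℝ U \ W) := (isCompact_stdSimplex ℝ U).diff hWo
  rcases (stdSimplex ℝ U \ W).eq_empty_or_nonempty with he | hne
  · exact ⟨1, one_pos, fun f hf _ => hWV (by
      by_contra hfW
      exact (Set.ext_iff.1 he f).1 ⟨hf, hfW⟩)⟩
  · obtain ⟨g, hg, hmin⟩ := hK.exists_isMinOn hne
      ((h.continuousOn_truncDrift hM).mono Set.sdiff_subset)
    refine ⟨_, hpos g hg.1 fun hgs => hg.2 (hgs ▸ hW), fun f hf hlt => hWV ?_⟩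
    by_contra hfW
    exact absurd (hmin ⟨hf, hfW⟩) (not_le.2 hlt)

end Drift

/-! ### Linearization of the mean recursion at the minimizer -/

section Linearization

variable {𝒴 U : Type*}

/-- The deviation of `f` from `fs` in the coordinates `(f u - fs u) / √(fs u)`, in which the
derivative of the mean recursion is a symmetric operator. -/
noncomputable def deviation (fs f : U → ℝ) : EuclideanSpace ℝ U :=
  WithLp.toLp 2 fun u => (f u - fs u) / √(fs u)

theorem continuous_deviation (fs : U → ℝ) : Continuous (deviation fs) := by
  unfold deviation
  exact (PiLp.continuous_toLp 2 _).comp (by fun_prop)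

variable [Fintype U]

theorem abs_apply_le_norm (x : EuclideanSpace ℝ U) (u : U) : |x u| ≤ ‖x‖ := by
  rw [← Real.norm_eq_abs]; exact PiLp.norm_apply_le x u

theorem norm_le_sum_abs (x : EuclideanSpace ℝ U) : ‖x‖ ≤ ∑ u, |x u| := by
  rw [EuclideanSpace.norm_eq]
  refine Real.sqrt_le_iff.2 ⟨Finset.sum_nonneg fun u _ => abs_nonneg _, ?_⟩
  simp only [Real.norm_eq_abs]
  exact Finset.sum_sq_le_sq_sum_of_nonneg fun u _ => abs_nonneg _

theorem sum_abs_sub_div_le {fs : U → ℝ} (hfs : ∀ u, 0 < fs u) (f : U → ℝ) :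
    ∑ u, |f u - fs u| / fs u ≤ (∑ u, (√(fs u))⁻¹) * ‖deviation fs f‖ := by
  rw [Finset.sum_mul]
  refine Finset.sum_le_sum fun u _ => ?_
  have h1 := abs_apply_le_norm (deviation fs f) u
  have h0 := Real.sqrt_pos.2 (hfs u)
  have e : |f u - fs u| / fs u = (√(fs u))⁻¹ * |deviation fs f u| := by
    have h2 : √(fs u) * √(fs u) = fs u := Real.mul_self_sqrt (hfs u).le
    rw [deviation, PiLp.toLp_apply, abs_div, abs_of_pos h0]
    nth_rewrite 2 [← h2]
    field_simp
  rw [e]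
  exact mul_le_mul_of_nonneg_left h1 (inv_pos.2 h0).le

theorem abs_linearization_integrand_le {p : 𝒴 → U → ℝ} {y : 𝒴} {fs : U → ℝ}
    (hp : ∀ u, 0 < p y u)
    (hmem : fs ∈ stdSimplex ℝ U) (hfs : ∀ u, 0 < fs u) {f : U → ℝ} (hf : f ∈ stdSimplex ℝ U)
    (hnear : ∀ u, fs u / 2 ≤ f u) (u : U) :
    |p y u * f u / mixture p f y - f u * (p y u / mixture p fs y) +
      fs u * (p y u / mixture p fs y * (mixture p (f - fs) y / mixture p fs y))| ≤
      4 * (∑ v, |f v - fs v| / fs v) ^ 2 := by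
  set β := ∑ v, |f v - fs v| / fs v with hβ
  have hf0 : 0 < f u := (half_pos (hfs u)).trans_le (hnear u)
  have a := mixture_pos hp hmem
  have b := mixture_pos hp hf
  set s := mixture p (f - fs) y / mixture p fs y with hs
  set r := p y u / mixture p f y with hr
  have e : p y u * f u / mixture p f y - f u * (p y u / mixture p fs y) +
      fs u * (p y u / mixture p fs y * s) = r * (fs u * s - (f u - fs u)) * s := by
    simp only [hr, hs, mixture_sub]
    field_simp; ring
  have hsβ : |s| ≤ β := by
    simpa using abs_mixture_div_le (fun u => (hp u).le) hfs (f - fs)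
  have hβ0 : 0 ≤ β := (abs_nonneg _).trans hsβ
  have hdβ : |f u - fs u| ≤ fs u * β := by
    have : |f u - fs u| / fs u ≤ β :=
      Finset.single_le_sum (f := fun u => |f u - fs u| / fs u)
        (fun u _ => div_nonneg (abs_nonneg _) (hfs u).le) (Finset.mem_univ u)
    rwa [div_le_iff₀ (hfs u), mul_comm] at this
  have hr0 : 0 ≤ r := div_nonneg (hp u).le b.le
  have hr1 : r * fs u ≤ 2 := by
    have h1 : r ≤ (f u)⁻¹ := div_mixture_le_inv (fun u => (hp u).le) hf.1 hf0
    have h2 : r * f u ≤ 1 := by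
      rw [← le_div_iff₀ hf0, one_div]; exact h1
    nlinarith [hnear u]
  rw [e, abs_mul, abs_mul, abs_of_nonneg hr0]
  have h1 : |fs u * s - (f u - fs u)| ≤ fs u * β + fs u * β := by
    refine (abs_sub _ _).trans (add_le_add ?_ hdβ)
    rw [abs_mul, abs_of_pos (hfs u)]
    exact mul_le_mul_of_nonneg_left hsβ (hfs u).le
  calc r * |fs u * s - (f u - fs u)| * |s| ≤ r * (fs u * β + fs u * β) * β := by
        have := hfs u; gcongr
    _ = 2 * (r * fs u) * β ^ 2 := by ring
    _ ≤ 2 * 2 * β ^ 2 := by gcongr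
    _ = _ := by ring

variable [MeasurableSpace 𝒴]

/-- The derivative at `fs` of the mean recursion in the coordinates of `deviation`: minus the
second-moment matrix of the vector `√(fs u) * p(· ∣ u) / m_fs`. -/
noncomputable def driftOp (μ : Measure 𝒴) (p : 𝒴 → U → ℝ) (fs : U → ℝ) :
    EuclideanSpace ℝ U →L[ℝ] EuclideanSpace ℝ U :=
  LinearMap.toContinuousLinearMap
    (-((WithLp.linearEquiv 2 ℝ (U → ℝ)).symm.toLinearMap ∘ₗ
      (Matrix.of fun u v => ∫ y, (√(fs u) * (p y u / mixture p fs y)) *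
        (√(fs v) * (p y v / mixture p fs y)) ∂μ).mulVecLin ∘ₗ
      (WithLp.linearEquiv 2 ℝ (U → ℝ)).toLinearMap))

variable {μ : Measure 𝒴} [IsProbabilityMeasure μ] {p : 𝒴 → U → ℝ} {fs : U → ℝ}

theorem IsRegular.integrable_div_mul_mixture_div (h : IsRegular μ p fs) {f : U → ℝ}
    (hf : ∀ u, 0 < f u) (d : U → ℝ) (u : U) :
    Integrable (fun y => p y u / mixture p f y * (mixture p d y / mixture p fs y)) μ := by
  refine (h.integrable_mixture_div h.pos d).bdd_mul (c := (f u)⁻¹)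
    ((h.measurable u).div (measurable_mixture h.measurable f)).aestronglyMeasurable
    (ae_of_all _ fun y => ?_)
  rw [Real.norm_eq_abs, abs_of_nonneg (div_nonneg (h.nonneg y u)
    (mixture_nonneg (h.nonneg y) fun u => (hf u).le))]
  exact div_mixture_le_inv (h.nonneg y) (fun u => (hf u).le) (hf u)

theorem IsRegular.driftOp_apply (h : IsRegular μ p fs) (x : EuclideanSpace ℝ U) (u : U) :
    driftOp μ p fs x u = -(√(fs u) * ∫ y, p y u / mixture p fs y *
      (mixture p (fun v => √(fs v) * x v) y / mixture p fs y) ∂μ) := by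
  have h1 : ∀ v, Integrable (fun y => p y u / mixture p fs y * (p y v / mixture p fs y)) μ := by
    intro v
    classical
    have := h.integrable_div_mul_mixture_div h.pos (Pi.single v 1) u
    simpa [mixture, Pi.single_apply] using this
  have h2 : ∀ y, p y u / mixture p fs y *
      (mixture p (fun v => √(fs v) * x v) y / mixture p fs y) =
      ∑ v, (√(fs v) * x v) * (p y u / mixture p fs y * (p y v / mixture p fs y)) := by
    intro y
    rw [← sum_mul_div_mixture, Finset.mul_sum]
    exact Finset.sum_congr rfl fun v _ => by ring
  simp only [h2]
  rw [integral_finsetSum _ fun v _ => (h1 v).const_mul _, Finset.mul_sum]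
  simp only [driftOp, LinearMap.coe_toContinuousLinearMap', LinearMap.neg_apply, PiLp.neg_apply]
  congr 1
  change ∑ v, _ * x v = _
  refine Finset.sum_congr rfl fun v _ => ?_
  rw [Matrix.of_apply, integral_const_mul]
  have : ∀ y, (√(fs u) * (p y u / mixture p fs y)) * (√(fs v) * (p y v / mixture p fs y)) =
      √(fs u) * √(fs v) * (p y u / mixture p fs y * (p y v / mixture p fs y)) := fun y => by ring
  simp only [this, integral_const_mul]
  ring

theorem IsRegular.inner_driftOp (h : IsRegular μ p fs) (x : EuclideanSpace ℝ U) :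
    inner ℝ x (driftOp μ p fs x) =
      -∫ y, (mixture p (fun v => √(fs v) * x v) y / mixture p fs y) ^ 2 ∂μ := by
  set d : U → ℝ := fun v => √(fs v) * x v with hd
  have e : ∀ y, (mixture p d y / mixture p fs y) ^ 2 =
      ∑ u, d u * (p y u / mixture p fs y * (mixture p d y / mixture p fs y)) := by
    intro y
    rw [sq]
    nth_rewrite 1 [← sum_mul_div_mixture]
    rw [Finset.sum_mul]
    exact Finset.sum_congr rfl fun u _ => by ring
  simp only [e]
  rw [integral_finsetSum _ fun u _ => (h.integrable_div_mul_mixture_div h.pos d u).const_mul _,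
    PiLp.inner_apply, ← Finset.sum_neg_distrib]
  refine Finset.sum_congr rfl fun u _ => ?_
  rw [h.driftOp_apply, integral_const_mul]
  simp only [hd, RCLike.inner_apply, conj_trivial]
  ring

/-- A perturbation direction along which the mixture does not change vanishes. That it has mass
zero is not assumed: it follows from the first-order conditions `hR`. -/
theorem IsRegular.eq_zero_of_mixture_eq_zero (h : IsRegular μ p fs)
    (hR : ∀ u, ∫ y, p y u / mixture p fs y ∂μ = 1) (hident : Identifiable μ p) {d : U → ℝ}
    (hd : ∀ᵐ y ∂μ, mixture p d y / mixture p fs y = 0) : d = 0 := by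
  have hsum : ∑ u, d u = 0 := by
    have := h.integral_mixture_div h.pos d
    rw [integral_congr_ae hd] at this
    simpa [hR] using this.symm
  set b := ∑ u, |d u| / fs u with hb
  have hb0 : 0 ≤ b := Finset.sum_nonneg fun u _ => div_nonneg (abs_nonneg _) (h.pos u).le
  set t : ℝ := 1 / (b + 1) with ht
  have ht0 : 0 < t := by positivity
  have hmem : fs + t • d ∈ stdSimplex ℝ U := by
    refine ⟨fun u => ?_, ?_⟩
    · have h1 : |d u| / fs u ≤ b :=
        Finset.single_le_sum (f := fun u => |d u| / fs u)
          (fun u _ => div_nonneg (abs_nonneg _) (h.pos u).le) (Finset.mem_univ u)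
      have hp := h.pos u
      rw [div_le_iff₀ hp] at h1
      have h2 : t * |d u| ≤ fs u := by
        rw [ht, one_div, inv_mul_le_iff₀ (by positivity)]
        nlinarith
      have h3 := neg_abs_le (d u)
      simp only [Pi.add_apply, Pi.smul_apply, smul_eq_mul]
      nlinarith
    · simp [Finset.sum_add_distrib, ← Finset.mul_sum, hsum, h.mem.2]
  have heq : fs + t • d = fs := by
    refine hident _ hmem _ h.mem ?_
    filter_upwards [hd, h.ae_pos] with y hy hpos
    have h0 := (div_eq_zero_iff.1 hy).resolve_right (mixture_pos hpos h.mem).ne'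
    rw [mixture_add, mixture_smul, h0, mul_zero, add_zero]
  have h1 : t • d = 0 := by simpa using heq
  exact (smul_eq_zero.1 h1).resolve_left ht0.ne'

theorem IsRegular.inner_driftOp_neg (h : IsRegular μ p fs)
    (hR : ∀ u, ∫ y, p y u / mixture p fs y ∂μ = 1) (hident : Identifiable μ p)
    {x : EuclideanSpace ℝ U} (hx : x ≠ 0) : inner ℝ x (driftOp μ p fs x) < 0 := by
  rw [h.inner_driftOp, neg_lt_zero]
  set d : U → ℝ := fun v => √(fs v) * x v with hd
  refine lt_of_le_of_ne (integral_nonneg fun y => sq_nonneg _) fun h0 => hx ?_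
  have hint : Integrable (fun y => (mixture p d y / mixture p fs y) ^ 2) μ := by
    have hm : Measurable fun y => mixture p d y / mixture p fs y :=
      (measurable_mixture h.measurable d).div (measurable_mixture h.measurable fs)
    refine Integrable.of_bound (hm.pow_const 2).aestronglyMeasurable
      ((∑ u, |d u| / fs u) ^ 2) (ae_of_all _ fun y => ?_)
    have := abs_mixture_div_le (h.nonneg y) h.pos d
    rw [norm_pow, Real.norm_eq_abs]; gcongr
  have hz := (integral_eq_zero_iff_of_nonneg (fun y => sq_nonneg _) hint).1 h0.symm
  have hd0 : d = 0 := h.eq_zero_of_mixture_eq_zero hR hident (by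
    filter_upwards [hz] with y hy using pow_eq_zero_iff (two_ne_zero) |>.1 hy)
  ext u
  have := congrFun hd0 u
  simpa [hd, (Real.sqrt_pos.2 (h.pos u)).ne'] using this

theorem IsRegular.exists_dissipation (h : IsRegular μ p fs)
    (hR : ∀ u, ∫ y, p y u / mixture p fs y ∂μ = 1) (hident : Identifiable μ p) :
    ∃ c > 0, ∀ x, inner ℝ x (driftOp μ p fs x) ≤ -c * ‖x‖ ^ 2 := by
  set A := driftOp μ p fs with hA
  have hunit : ∃ c > 0, ∀ x ∈ Metric.sphere (0 : EuclideanSpace ℝ U) 1, inner ℝ x (A x) ≤ -c := by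
    rcases (Metric.sphere (0 : EuclideanSpace ℝ U) 1).eq_empty_or_nonempty with he | hne
    · exact ⟨1, one_pos, by simp [he]⟩
    · have hcont : Continuous fun x : EuclideanSpace ℝ U => inner ℝ x (A x) :=
        continuous_id.inner A.continuous
      obtain ⟨g, hg, hmax⟩ := (isCompact_sphere _ _).exists_isMaxOn hne hcont.continuousOn
      have hg0 : g ≠ 0 := by
        rintro rfl; simp at hg
      refine ⟨-inner ℝ g (A g), neg_pos.2 (h.inner_driftOp_neg hR hident hg0), fun x hx => ?_⟩
      rw [neg_neg]; exact hmax hx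
  obtain ⟨c, hc, hcx⟩ := hunit
  refine ⟨c, hc, fun x => ?_⟩
  by_cases hx : x = 0
  · simp [hx]
  have hn : 0 < ‖x‖ := norm_pos_iff.2 hx
  have h1 := hcx (‖x‖⁻¹ • x) (by simp [norm_smul, hn.ne'])
  rw [map_smul, inner_smul_left, inner_smul_right, conj_trivial] at h1
  have h2 := mul_le_mul_of_nonneg_left h1 (sq_nonneg ‖x‖)
  calc inner ℝ x (A x) = ‖x‖ ^ 2 * (‖x‖⁻¹ * (‖x‖⁻¹ * inner ℝ x (A x))) := by field_simp
    _ ≤ ‖x‖ ^ 2 * -c := h2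
    _ = _ := by ring

theorem IsRegular.abs_linearization_le (h : IsRegular μ p fs)
    (hR : ∀ u, ∫ y, p y u / mixture p fs y ∂μ = 1) {f : U → ℝ} (hf : f ∈ stdSimplex ℝ U)
    (hnear : ∀ u, fs u / 2 ≤ f u) (u : U) :
    |(∫ y, p y u * f u / mixture p f y ∂μ - f u) / √(fs u) -
      driftOp μ p fs (deviation fs f) u| ≤
      4 * (√(fs u))⁻¹ * (∑ v, |f v - fs v| / fs v) ^ 2 := by
  have hf0 : ∀ u, 0 < f u := fun u => (half_pos (h.pos u)).trans_le (hnear u)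
  have hsq := Real.sqrt_pos.2 (h.pos u)
  have hd : (fun v => √(fs v) * deviation fs f v) = f - fs := by
    ext v
    have := (Real.sqrt_pos.2 (h.pos v)).ne'
    simp only [deviation, PiLp.toLp_apply, Pi.sub_apply]
    field_simp
  have i1 : Integrable (fun y => p y u * f u / mixture p f y) μ := by
    refine ((h.integrable_div hf.1 (hf0 u)).mul_const (f u)).congr (ae_of_all _ fun y => ?_)
    simp only; ring
  have i2 : Integrable (fun y => f u * (p y u / mixture p fs y)) μ :=
    (h.integrable_div h.mem.1 (h.pos u)).const_mul _
  have i3 : Integrable (fun y => fs u * (p y u / mixture p fs y *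
      (mixture p (f - fs) y / mixture p fs y))) μ :=
    (h.integrable_div_mul_mixture_div h.pos (f - fs) u).const_mul _
  have i12 : Integrable (fun y => p y u * f u / mixture p f y -
      f u * (p y u / mixture p fs y)) μ := i1.sub i2
  have e : (∫ y, p y u * f u / mixture p f y ∂μ - f u) / √(fs u) -
      driftOp μ p fs (deviation fs f) u = (√(fs u))⁻¹ *
      ∫ y, (p y u * f u / mixture p f y - f u * (p y u / mixture p fs y) +
      fs u * (p y u / mixture p fs y * (mixture p (f - fs) y / mixture p fs y))) ∂μ := by
    rw [integral_add i12 i3, integral_sub i1 i2, integral_const_mul, integral_const_mul, hR,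
      h.driftOp_apply, hd]
    have h2 : (√(fs u))⁻¹ * fs u = √(fs u) := by
      rw [inv_mul_eq_div, Real.div_sqrt]
    rw [mul_add, ← mul_assoc _ (fs u), h2]
    ring
  have hbound : ‖∫ y, (p y u * f u / mixture p f y - f u * (p y u / mixture p fs y) +
      fs u * (p y u / mixture p fs y * (mixture p (f - fs) y / mixture p fs y))) ∂μ‖ ≤
      4 * (∑ v, |f v - fs v| / fs v) ^ 2 * μ.real Set.univ := by
    refine norm_integral_le_of_norm_le_const ?_
    filter_upwards [h.ae_pos] with y hy
    exact abs_linearization_integrand_le hy h.mem h.pos hf hnear u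
  rw [e, abs_mul, abs_of_pos (inv_pos.2 hsq)]
  simp only [probReal_univ, mul_one, Real.norm_eq_abs] at hbound
  calc _ ≤ (√(fs u))⁻¹ * (4 * (∑ v, |f v - fs v| / fs v) ^ 2) :=
        mul_le_mul_of_nonneg_left hbound (inv_pos.2 hsq).le
    _ = _ := by ring

/-- The mean recursion agrees with its linearization up to a quadratic error. -/
theorem IsRegular.exists_norm_linearization_le (h : IsRegular μ p fs)
    (hR : ∀ u, ∫ y, p y u / mixture p fs y ∂μ = 1) :
    ∃ C : ℝ, 0 ≤ C ∧ ∀ f ∈ stdSimplex ℝ U, (∀ u, fs u / 2 ≤ f u) →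
      ‖WithLp.toLp 2 (fun u => (∫ y, p y u * f u / mixture p f y ∂μ - f u) / √(fs u)) -
        driftOp μ p fs (deviation fs f)‖ ≤ C * ‖deviation fs f‖ ^ 2 := by
  set c₀ : ℝ := ∑ u, (√(fs u))⁻¹ with hc₀
  have hc₀0 : 0 ≤ c₀ := Finset.sum_nonneg fun u _ => inv_nonneg.2 (Real.sqrt_nonneg _)
  refine ⟨4 * c₀ * c₀ ^ 2, by positivity, fun f hf hnear => ?_⟩
  refine (norm_le_sum_abs _).trans ?_
  have hβ := sum_abs_sub_div_le h.pos f
  have hβ0 : 0 ≤ ∑ u, |f u - fs u| / fs u :=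
    Finset.sum_nonneg fun u _ => div_nonneg (abs_nonneg _) (h.pos u).le
  calc _ ≤ ∑ u, 4 * (√(fs u))⁻¹ * (∑ v, |f v - fs v| / fs v) ^ 2 :=
        Finset.sum_le_sum fun u _ => h.abs_linearization_le hR hf hnear u
    _ = 4 * c₀ * (∑ v, |f v - fs v| / fs v) ^ 2 := by
        rw [← Finset.sum_mul, ← Finset.mul_sum]
    _ ≤ 4 * c₀ * (c₀ * ‖deviation fs f‖) ^ 2 := by gcongr
    _ = _ := by ring

end Linearization

/-! ### Convergence of the recursion along one path -/

section Path

variable {𝒴 U : Type*} [Fintype U]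

/-- The Kullback-Leibler divergence of the probability vector `f` from `fs`. -/
noncomputable def divergence (fs f : U → ℝ) : ℝ :=
  ∑ u, fs u * (Real.log (fs u) - Real.log (f u))

theorem sum_sq_sqrt_sub_le_divergence {fs f : U → ℝ} (hfs : fs ∈ stdSimplex ℝ U)
    (hf : f ∈ stdSimplex ℝ U) (hfs0 : ∀ u, 0 < fs u) (hf0 : ∀ u, 0 < f u) :
    ∑ u, (√(fs u) - √(f u)) ^ 2 ≤ divergence fs f := by
  have key : ∀ u, (√(fs u) - √(f u)) ^ 2 ≤
      fs u * (Real.log (fs u) - Real.log (f u)) + (f u - fs u) := by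
    intro u
    have a := Real.sqrt_pos.2 (hfs0 u)
    have b := Real.sqrt_pos.2 (hf0 u)
    have a2 := Real.sq_sqrt (hfs0 u).le
    have b2 := Real.sq_sqrt (hf0 u).le
    have h1 := Real.log_le_sub_one_of_pos (div_pos b a)
    rw [Real.log_div b.ne' a.ne', Real.log_sqrt (hf0 u).le, Real.log_sqrt (hfs0 u).le] at h1
    have h2 := mul_le_mul_of_nonneg_left h1 (hfs0 u).le
    have h3 : fs u * (√(f u) / √(fs u) - 1) = √(fs u) * √(f u) - fs u := by
      rw [mul_sub, mul_one, mul_div_assoc', mul_comm (fs u), mul_div_assoc, Real.div_sqrt]; ring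
    rw [h3] at h2
    nlinarith
  calc _ ≤ ∑ u, (fs u * (Real.log (fs u) - Real.log (f u)) + (f u - fs u)) :=
        Finset.sum_le_sum fun u _ => key u
    _ = divergence fs f := by
        rw [Finset.sum_add_distrib, Finset.sum_sub_distrib, hf.2, hfs.2, sub_self, add_zero,
          divergence]

theorem divergence_nonneg {fs f : U → ℝ} (hfs : fs ∈ stdSimplex ℝ U)
    (hf : f ∈ stdSimplex ℝ U) (hfs0 : ∀ u, 0 < fs u) (hf0 : ∀ u, 0 < f u) :
    0 ≤ divergence fs f :=
  (Finset.sum_nonneg fun _ _ => sq_nonneg _).trans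
    (sum_sq_sqrt_sub_le_divergence hfs hf hfs0 hf0)

theorem continuousAt_divergence {fs : U → ℝ} (hfs0 : ∀ u, 0 < fs u) :
    ContinuousAt (divergence fs) fs := by
  unfold divergence
  refine tendsto_finsetSum _ fun u _ => Tendsto.const_mul _ (Tendsto.const_sub _ ?_)
  exact (continuous_apply u).continuousAt.log (hfs0 u).ne'

theorem tendsto_of_tendsto_divergence {fs : U → ℝ} (hfs : fs ∈ stdSimplex ℝ U)
    (hfs0 : ∀ u, 0 < fs u) {f : ℕ → U → ℝ} (hf : ∀ n, f n ∈ stdSimplex ℝ U)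
    (hf0 : ∀ n u, 0 < f n u) (h : Tendsto (fun n => divergence fs (f n)) atTop (𝓝 0)) :
    Tendsto f atTop (𝓝 fs) := by
  rw [tendsto_pi_nhds]
  intro u
  have h1 : Tendsto (fun n => (√(fs u) - √(f n u)) ^ 2) atTop (𝓝 0) := by
    refine squeeze_zero (fun n => sq_nonneg _) (fun n => ?_) h
    exact (Finset.single_le_sum (f := fun u => (√(fs u) - √(f n u)) ^ 2)
      (fun u _ => sq_nonneg _) (Finset.mem_univ u)).trans
      (sum_sq_sqrt_sub_le_divergence hfs (hf n) hfs0 (hf0 n))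
  have h2 : Tendsto (fun n => √(fs u) - √(f n u)) atTop (𝓝 0) := by
    have := h1.sqrt
    simp only [Real.sqrt_sq_eq_abs, Real.sqrt_zero] at this
    exact (tendsto_zero_iff_abs_tendsto_zero _).2 this
  have h3 : Tendsto (fun n => √(f n u)) atTop (𝓝 (√(fs u))) := by
    simpa using h2.const_sub (√(fs u))
  have h4 := h3.pow 2
  simpa only [Real.sq_sqrt (hf0 _ u).le, Real.sq_sqrt (hfs0 u).le] using h4

/-- Since the logarithm is increasing, a likelihood ratio may be cut off before expanding, so that
the second-order term stays bounded however heavy the tail of the ratio is. -/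
theorem log_step_ge {w r M : ℝ} (hw : w ∈ Set.Ioo (0 : ℝ) 1) (hr : 0 ≤ r) (hM : 1 ≤ M) :
    w * (min r M - 1) - w ^ 2 * (M ^ 2 * (1 - w)⁻¹) ≤ Real.log (1 - w + w * r) := by
  obtain ⟨hw0, hw1⟩ := hw
  set a := min r M with ha
  have ha0 : 0 ≤ a := le_min hr (by linarith)
  have haM : a ≤ M := min_le_right _ _
  have har : a ≤ r := min_le_left _ _
  set t := w * (a - 1) with ht
  have ht1 : 1 - w ≤ 1 + t := by
    have := mul_nonneg hw0.le ha0; rw [ht]; linarith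
  have hpos : 0 < 1 + t := by linarith
  have h1 : Real.log (1 + t) ≤ Real.log (1 - w + w * r) := by
    refine Real.log_le_log hpos ?_
    have := mul_le_mul_of_nonneg_left har hw0.le
    rw [ht]; linarith
  have h2 := Real.one_sub_inv_le_log_of_pos hpos
  have h3 : 1 - (1 + t)⁻¹ = t - t ^ 2 * (1 + t)⁻¹ := by field_simp; ring
  have h4 : t ^ 2 * (1 + t)⁻¹ ≤ w ^ 2 * (M ^ 2 * (1 - w)⁻¹) := by
    have e : t ^ 2 = w ^ 2 * (a - 1) ^ 2 := by rw [ht]; ring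
    have h5 : (a - 1) ^ 2 ≤ M ^ 2 := by
      apply sq_le_sq'
      · linarith
      · linarith
    have h6 : (1 + t)⁻¹ ≤ (1 - w)⁻¹ := inv_anti₀ (by linarith) ht1
    rw [e, mul_assoc]
    have := (inv_pos.2 hpos).le
    gcongr
  linarith

theorem divergence_step_le {p : 𝒴 → U → ℝ} {y : 𝒴} (hp : ∀ u, 0 ≤ p y u) {fs : U → ℝ}
    (hfs : fs ∈ stdSimplex ℝ U) {M : ℝ} (hM : 1 ≤ M) {w : ℝ} (hw : w ∈ Set.Ioo (0 : ℝ) 1)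
    {f f' : U → ℝ} (hf0 : ∀ u, 0 < f u)
    (hstep : ∀ u, f' u = (1 - w) * f u + w * (p y u * f u / mixture p f y)) :
    divergence fs f' ≤ divergence fs f - w * (truncRatio p fs M f y - 1) +
      w ^ 2 * (M ^ 2 * (1 - w)⁻¹) := by
  have key : ∀ u, fs u * (Real.log (fs u) - Real.log (f' u)) ≤
      fs u * (Real.log (fs u) - Real.log (f u)) -
        w * (fs u * min (p y u / mixture p f y) M - fs u) +
        fs u * (w ^ 2 * (M ^ 2 * (1 - w)⁻¹)) := by
    intro u
    have hr : 0 ≤ p y u / mixture p f y :=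
      div_nonneg (hp u) (mixture_nonneg hp fun u => (hf0 u).le)
    have e : f' u = f u * (1 - w + w * (p y u / mixture p f y)) := by rw [hstep]; ring
    have hpos : 0 < 1 - w + w * (p y u / mixture p f y) := by
      have := mul_nonneg hw.1.le hr; have := hw.2; linarith
    have h1 := mul_le_mul_of_nonneg_left (log_step_ge hw hr hM) (hfs.1 u)
    rw [e, Real.log_mul (hf0 u).ne' hpos.ne']
    linarith
  refine (Finset.sum_le_sum fun u _ => key u).trans (le_of_eq ?_)
  rw [Finset.sum_add_distrib, Finset.sum_sub_distrib, ← Finset.mul_sum, ← Finset.sum_mul,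
    Finset.sum_sub_distrib, hfs.2, one_mul, divergence, truncRatio]

variable [MeasurableSpace 𝒴] {μ : Measure 𝒴} [IsProbabilityMeasure μ] {p : 𝒴 → U → ℝ}
  {fs : U → ℝ}

/-- Along a path on which the noise series of the truncated likelihood ratios converges, the
recursion converges to `fs`. -/
theorem IsRegular.tendsto_of_noise (h : IsRegular μ p fs) {M : ℝ} (hM : 1 ≤ M)
    (hM0 : truncDrift μ p fs M fs = 0)
    (hpos : ∀ f ∈ stdSimplex ℝ U, f ≠ fs → 0 < truncDrift μ p fs M f)
    {w : ℕ → ℝ} (hw : ∀ n, w n ∈ Set.Ioo (0 : ℝ) 1)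
    (hdiv : Tendsto (fun N => ∑ n ∈ Finset.range N, w n) atTop atTop)
    (hw2 : Summable fun n => w n ^ 2) {f : ℕ → U → ℝ} {y : ℕ → 𝒴}
    (hf : ∀ n, f n ∈ stdSimplex ℝ U) (hf0 : ∀ n u, 0 < f n u)
    (hrec : ∀ n u, f (n + 1) u =
      (1 - w n) * f n u + w n * (p (y n) u * f n u / mixture p (f n) (y n)))
    (hS : ∃ S, Tendsto (fun n => ∑ k ∈ Finset.range n, w k *
      (truncRatio p fs M (f k) (y k) - ∫ y, truncRatio p fs M (f k) y ∂μ)) atTop (𝓝 S)) :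
    Tendsto f atTop (𝓝 fs) := by
  obtain ⟨S, hS⟩ := hS
  have hwt : Tendsto w atTop (𝓝 0) := by
    have := hw2.tendsto_atTop_zero.sqrt
    simp only [Real.sqrt_zero] at this
    exact this.congr fun n => Real.sqrt_sq (hw n).1.le
  obtain ⟨B, hB⟩ : ∃ B, ∀ n, (1 - w n)⁻¹ ≤ B := by
    have : Tendsto (fun n => (1 - w n)⁻¹) atTop (𝓝 ((1 - 0)⁻¹)) :=
      (hwt.const_sub 1).inv₀ (by norm_num)
    obtain ⟨B, hB⟩ := this.bddAbove_range
    exact ⟨B, fun n => hB ⟨n, rfl⟩⟩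
  set Φ : ℕ → ℝ := fun n => truncDrift μ p fs M (f n) with hΦ
  have hΦ0 : ∀ n, 0 ≤ Φ n := fun n => by
    by_cases hn : f n = fs
    · simp [hΦ, hn, hM0]
    · exact (hpos _ (hf n) hn).le
  set s : ℕ → ℝ := fun k => -(w k *
      (truncRatio p fs M (f k) (y k) - ∫ y, truncRatio p fs M (f k) y ∂μ)) +
      w k ^ 2 * (M ^ 2 * B) with hs
  have hslim : Tendsto (fun N => ∑ n ∈ Finset.range N, s n) atTop
      (𝓝 (-S + (∑' n, w n ^ 2) * (M ^ 2 * B))) := by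
    simp only [hs, Finset.sum_add_distrib, Finset.sum_neg_distrib, ← Finset.sum_mul]
    exact hS.neg.add (hw2.hasSum.tendsto_sum_nat.mul_const _)
  have hstep : ∀ n, divergence fs (f (n + 1)) ≤ divergence fs (f n) - w n * Φ n + s n := by
    intro n
    have h1 := divergence_step_le (h.nonneg (y n)) h.mem hM (hw n) (hf0 n) (hrec n)
    have h2 : w n ^ 2 * (M ^ 2 * (1 - w n)⁻¹) ≤ w n ^ 2 * (M ^ 2 * B) := by
      have := hB n; gcongr
    simp only [hs, hΦ, truncDrift]
    linarith
  obtain ⟨⟨L, hL⟩, hfreq⟩ := lyapunov_converges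
    (fun n => divergence_nonneg h.mem (hf n) h.pos (hf0 n)) hΦ0 (fun n => (hw n).1.le) hdiv
    hslim hstep
  have hL0 : 0 ≤ L := ge_of_tendsto' hL fun n => divergence_nonneg h.mem (hf n) h.pos (hf0 n)
  have hL1 : L ≤ 0 := by
    by_contra! hcon
    have hnear : {g | divergence fs g < L / 2} ∈ 𝓝 fs := by
      refine (continuousAt_divergence h.pos).eventually_lt_const ?_
      simp only [divergence, sub_self, mul_zero, Finset.sum_const_zero]
      linarith
    obtain ⟨ε, hε, hεV⟩ := h.exists_truncDrift_lt (by linarith) hpos hnear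
    obtain ⟨n, hn1, hn2⟩ := ((hfreq ε hε).and_eventually
      (hL.eventually_const_lt (half_lt_self hcon))).exists
    exact absurd (hεV _ (hf n) hn1) (not_lt.2 hn2.le)
  rw [le_antisymm hL1 hL0] at hL
  exact tendsto_of_tendsto_divergence h.mem h.pos hf hf0 hL

/-- Along a path on which the recursion converges to `fs` and the rescaled noise series converges,
the rate of convergence is `o (w n ^ δ)`. -/
theorem IsRegular.isLittleO_of_noise (h : IsRegular μ p fs)
    (hR : ∀ u, ∫ y, p y u / mixture p fs y ∂μ = 1) (hident : Identifiable μ p)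
    {w : ℕ → ℝ} (hw0 : ∀ n, 0 < w n) (hwt : Tendsto w atTop (𝓝 0))
    (hdiv : Tendsto (fun N => ∑ n ∈ Finset.range N, w (n + 1)) atTop atTop)
    (hreg : Tendsto (fun n => (w (n + 1))⁻¹ - (w n)⁻¹) atTop (𝓝 0))
    {δ : ℝ} (hδ0 : 0 ≤ δ) (hδ1 : δ ≤ 1) {f : ℕ → U → ℝ} {y : ℕ → 𝒴}
    (hf : ∀ n, f n ∈ stdSimplex ℝ U)
    (hrec : ∀ n u, f (n + 1) u =
      (1 - w (n + 1)) * f n u + w (n + 1) * (p (y n) u * f n u / mixture p (f n) (y n)))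
    (hlim : Tendsto f atTop (𝓝 fs))
    (hS : ∀ u, ∃ S, Tendsto (fun n => ∑ k ∈ Finset.range n, w (k + 1) ^ (1 - δ) *
      (p (y k) u * f k u / mixture p (f k) (y k) -
        ∫ y, p y u * f k u / mixture p (f k) y ∂μ)) atTop (𝓝 S)) :
    (fun n => deviation fs (f n)) =o[atTop] fun n => w n ^ δ := by
  choose S hS using hS
  obtain ⟨c, hc, hA⟩ := h.exists_dissipation hR hident
  obtain ⟨C, hC0, hC⟩ := h.exists_norm_linearization_le hR
  have hx0 : Tendsto (fun n => deviation fs (f n)) atTop (𝓝 0) := by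
    have h1 := ((continuous_deviation fs).tendsto fs).comp hlim
    have h2 : deviation fs fs = 0 := by ext u; simp [deviation]
    rwa [h2] at h1
  have hnear : ∀ᶠ n in atTop, ∀ u, fs u / 2 ≤ f n u := by
    refine eventually_all.2 fun u => ?_
    exact ((tendsto_pi_nhds.1 hlim u).eventually_const_lt (half_lt_self (h.pos u))).mono
      fun n hn => hn.le
  refine isLittleO_rpow_of_recursion (driftOp μ p fs) hc hA hw0 hwt hdiv hreg hδ0 hδ1
    (ρ := fun n => WithLp.toLp 2 (fun u =>
      (∫ y, p y u * f n u / mixture p (f n) y ∂μ - f n u) / √(fs u)) -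
        driftOp μ p fs (deviation fs (f n)))
    (e := fun n => WithLp.toLp 2 fun u => (p (y n) u * f n u / mixture p (f n) (y n) -
        ∫ y, p y u * f n u / mixture p (f n) y ∂μ) / √(fs u))
    (κ := fun n => C * ‖deviation fs (f n)‖) (S := WithLp.toLp 2 fun u => S u / √(fs u))
    (fun n => ?_) ?_ (fun n => mul_nonneg hC0 (norm_nonneg _)) ?_ ?_
  · ext u
    simp only [add_sub_cancel, deviation, PiLp.add_apply, PiLp.smul_apply, smul_eq_mul, hrec]
    ring
  · filter_upwards [hnear] with n hn
    refine (hC (f n) (hf n) hn).trans (le_of_eq ?_)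
    ring
  · simpa using hx0.norm.const_mul C
  · have h1 : Tendsto (fun n => (fun u => (∑ k ∈ Finset.range n, w (k + 1) ^ (1 - δ) *
        (p (y k) u * f k u / mixture p (f k) (y k) -
          ∫ y, p y u * f k u / mixture p (f k) y ∂μ)) / √(fs u))) atTop
        (𝓝 fun u => S u / √(fs u)) :=
      tendsto_pi_nhds.2 fun u => (hS u).div_const _
    refine (((PiLp.continuous_toLp 2 _).tendsto _).comp h1).congr fun n => ?_
    ext u
    simp only [Function.comp_apply, WithLp.ofLp_sum, Finset.sum_apply, smul_eq_mul,
      Finset.sum_div, WithLp.ofLp_smul, Pi.smul_apply]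
    exact Finset.sum_congr rfl fun k _ => by ring

end Path

/-! ### Kullback-Leibler divergences of mixtures -/

section KullbackLeibler

variable {𝒴 U : Type*} [MeasurableSpace 𝒴] {ν : Measure 𝒴}

theorem IsDensity.integrable {g : 𝒴 → ℝ} (hg : IsDensity ν g) : Integrable g ν := by
  by_contra h
  have := hg.integral_eq_one
  rw [integral_undef h] at this
  exact zero_ne_one this

theorem IsDensity.isProbabilityMeasure_law {g : 𝒴 → ℝ} (hg : IsDensity ν g) :
    IsProbabilityMeasure (law ν g) := by
  constructor
  rw [law, withDensity_apply _ MeasurableSet.univ, Measure.restrict_univ,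
    ← ofReal_integral_eq_lintegral_ofReal hg.integrable (ae_of_all _ hg.nonneg),
    hg.integral_eq_one, ENNReal.ofReal_one]

theorem IsDensity.ae_law_pos {g : 𝒴 → ℝ} (hg : IsDensity ν g) : ∀ᵐ y ∂law ν g, 0 < g y := by
  rw [law, ae_withDensity_iff hg.measurable.ennreal_ofReal]
  exact ae_of_all _ fun y hy => by
    rw [← ENNReal.ofReal_pos]; exact pos_iff_ne_zero.2 hy

theorem ae_pos_of_KL_lt_top {m g : 𝒴 → ℝ} (hg : IsDensity ν g) (hfin : KL ν m g < ⊤) :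
    ∀ᵐ y ∂law ν m, 0 < g y :=
  (InformationTheory.klDiv_ne_top_iff.1 hfin.ne).1.ae_le hg.ae_law_pos

theorem llr_law_ae_eq [SigmaFinite ν] {m g : 𝒴 → ℝ} (hm : IsDensity ν m) (hg : IsDensity ν g)
    (hfin : KL ν m g < ⊤) :
    llr (law ν m) (law ν g) =ᵐ[law ν m] fun y => Real.log (m y) - Real.log (g y) := by
  have := hm.isProbabilityMeasure_law
  have := hg.isProbabilityMeasure_law
  have hac := (InformationTheory.klDiv_ne_top_iff.1 hfin.ne).1
  have hν : law ν m ≪ ν := withDensity_absolutelyContinuous _ _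
  have h1 := hν.ae_le (Measure.rnDeriv_mul_rnDeriv (κ := ν) hac)
  have h2 := hν.ae_le (Measure.rnDeriv_withDensity ν hm.measurable.ennreal_ofReal)
  have h3 := hν.ae_le (Measure.rnDeriv_withDensity ν hg.measurable.ennreal_ofReal)
  filter_upwards [h1, h2, h3, hm.ae_law_pos, ae_pos_of_KL_lt_top hg hfin] with y h1 h2 h3 hmy hgy
  rw [Pi.mul_apply, law, law, h2, h3] at h1
  have h4 := congrArg ENNReal.toReal h1
  rw [ENNReal.toReal_mul, ENNReal.toReal_ofReal hmy.le, ENNReal.toReal_ofReal hgy.le] at h4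
  rw [llr, law, law, eq_div_of_mul_eq hgy.ne' h4, Real.log_div hmy.ne' hgy.ne']

theorem integrable_log_sub_log [SigmaFinite ν] {m g : 𝒴 → ℝ} (hm : IsDensity ν m)
    (hg : IsDensity ν g) (hfin : KL ν m g < ⊤) :
    Integrable (fun y => Real.log (m y) - Real.log (g y)) (law ν m) :=
  (InformationTheory.klDiv_ne_top_iff.1 hfin.ne).2.congr (llr_law_ae_eq hm hg hfin)

theorem toReal_KL [SigmaFinite ν] {m g : 𝒴 → ℝ} (hm : IsDensity ν m) (hg : IsDensity ν g)
    (hfin : KL ν m g < ⊤) :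
    (KL ν m g).toReal = ∫ y, (Real.log (m y) - Real.log (g y)) ∂law ν m := by
  have := hm.isProbabilityMeasure_law
  have := hg.isProbabilityMeasure_law
  have hac := (InformationTheory.klDiv_ne_top_iff.1 hfin.ne).1
  rw [KL, InformationTheory.toReal_klDiv_of_measure_eq hac (by simp),
    integral_congr_ae (llr_law_ae_eq hm hg hfin)]

theorem toReal_KL_sub [SigmaFinite ν] {m g g' : 𝒴 → ℝ} (hm : IsDensity ν m) (hg : IsDensity ν g)
    (hg' : IsDensity ν g') (hfin : KL ν m g < ⊤) (hfin' : KL ν m g' < ⊤) :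
    (KL ν m g).toReal - (KL ν m g').toReal = -∫ y, Real.log (g y / g' y) ∂law ν m := by
  rw [toReal_KL hm hg hfin, toReal_KL hm hg' hfin',
    ← integral_sub (integrable_log_sub_log hm hg hfin) (integrable_log_sub_log hm hg' hfin'),
    ← integral_neg]
  refine integral_congr_ae ?_
  filter_upwards [ae_pos_of_KL_lt_top hg hfin, ae_pos_of_KL_lt_top hg' hfin'] with y h1 h2
  rw [Real.log_div h1.ne' h2.ne']
  ring

variable [Fintype U]

theorem isDensity_mixture {p : 𝒴 → U → ℝ} (hp : ∀ u, IsDensity ν fun y => p y u) {f : U → ℝ}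
    (hf : f ∈ stdSimplex ℝ U) : IsDensity ν (mixture p f) where
  measurable := measurable_mixture (fun u => (hp u).measurable) f
  nonneg _ := mixture_nonneg (fun u => (hp u).nonneg _) hf.1
  integral_eq_one := by
    unfold mixture
    rw [integral_finsetSum _ fun u _ => (hp u).integrable.mul_const _]
    simp only [integral_mul_const, (hp _).integral_eq_one, one_mul, hf.2]

theorem integral_abs_mixture_sub_le {p : 𝒴 → U → ℝ} (hp : ∀ u, IsDensity ν fun y => p y u)
    (f g : U → ℝ) : ∫ y, |mixture p f y - mixture p g y| ∂ν ≤ ∑ u, |f u - g u| := by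
  have hint : Integrable (fun y => ∑ u, p y u * |f u - g u|) ν :=
    integrable_finsetSum _ fun u _ => (hp u).integrable.mul_const _
  have hmono : ∫ y, |mixture p f y - mixture p g y| ∂ν ≤ ∫ y, ∑ u, p y u * |f u - g u| ∂ν := by
    refine integral_mono_of_nonneg (ae_of_all _ fun y => abs_nonneg _) hint
      (ae_of_all _ fun y => ?_)
    simp only [← mixture_sub]
    refine (Finset.abs_sum_le_sum_abs _ _).trans (Finset.sum_le_sum fun u _ => ?_)
    rw [abs_mul, abs_of_nonneg ((hp u).nonneg y), Pi.sub_apply]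
  refine hmono.trans (le_of_eq ?_)
  rw [integral_finsetSum _ fun u _ => (hp u).integrable.mul_const _]
  simp only [integral_mul_const, (hp _).integral_eq_one, one_mul]

theorem isRegular_law {m : 𝒴 → ℝ} {p : 𝒴 → U → ℝ} (hp : ∀ u, IsDensity ν fun y => p y u)
    (hfin : ∀ f ∈ stdSimplex ℝ U, KL ν m (mixture p f) < ⊤) {fs : U → ℝ}
    (hfs : fs ∈ stdSimplex ℝ U) (hpos : ∀ u, 0 < fs u) : IsRegular (law ν m) p fs where
  measurable u := (hp u).measurable
  nonneg y u := (hp u).nonneg y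
  ae_pos := by
    classical
    refine ae_all_iff.2 fun u => ?_
    have hu : Pi.single u 1 ∈ stdSimplex ℝ U := single_mem_stdSimplex ℝ u
    have := ae_pos_of_KL_lt_top (isDensity_mixture hp hu) (hfin _ hu)
    filter_upwards [this] with y hy
    simpa [mixture, Pi.single_apply] using hy
  mem := hfs
  pos := hpos

end KullbackLeibler

/-! ### The recursion as a random process -/

section Recursion

variable {𝒴 U : Type*} [Fintype U]

theorem predRec_congr (p : 𝒴 → U → ℝ) {w w' : ℕ → ℝ} (hw : ∀ n, w (n + 1) = w' (n + 1))
    (f₀ : U → ℝ) {y y' : ℕ → 𝒴} (hy : ∀ n, y (n + 1) = y' (n + 1)) (n : ℕ) :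
    predRec p w f₀ y n = predRec p w' f₀ y' n := by
  induction n with
  | zero => rfl
  | succ n ih => ext u; simp only [predRec, ih, hy, hw]

theorem predRec_pos {p : 𝒴 → U → ℝ} (hp : ∀ y u, 0 ≤ p y u) {w : ℕ → ℝ}
    (hw : ∀ n, w n ∈ Set.Ioo (0 : ℝ) 1) {f₀ : U → ℝ} (hf₀ : ∀ u, 0 < f₀ u) (y : ℕ → 𝒴) (n : ℕ)
    (u : U) : 0 < predRec p w f₀ y n u := by
  induction n generalizing u with
  | zero => exact hf₀ u
  | succ n ih =>
    have h1 := mul_pos (sub_pos.2 (hw (n + 1)).2) (ih u)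
    have h2 : 0 ≤ w (n + 1) * (p (y (n + 1)) u * predRec p w f₀ y n u /
        mixture p (predRec p w f₀ y n) (y (n + 1))) :=
      mul_nonneg (hw _).1.le (div_nonneg (mul_nonneg (hp _ u) (ih u).le)
        (mixture_nonneg (hp _) fun u => (ih u).le))
    exact add_pos_of_pos_of_nonneg h1 h2

theorem predRec_mem_stdSimplex {p : 𝒴 → U → ℝ} (hp : ∀ y u, 0 ≤ p y u) {w : ℕ → ℝ}
    (hw : ∀ n, w n ∈ Set.Ioo (0 : ℝ) 1) {f₀ : U → ℝ} (hf₀ : f₀ ∈ stdSimplex ℝ U)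
    (hf₀pos : ∀ u, 0 < f₀ u) {y : ℕ → 𝒴} (hy : ∀ n u, 0 < p (y (n + 1)) u) (n : ℕ) :
    predRec p w f₀ y n ∈ stdSimplex ℝ U := by
  induction n with
  | zero => exact hf₀
  | succ n ih =>
    refine ⟨fun u => (predRec_pos hp hw hf₀pos y (n + 1) u).le, ?_⟩
    simp only [predRec, Finset.sum_add_distrib, ← Finset.mul_sum, ← Finset.sum_div, ih.2]
    have : ∑ u, p (y (n + 1)) u * predRec p w f₀ y n u =
        mixture p (predRec p w f₀ y n) (y (n + 1)) := rfl
    rw [this, div_self (mixture_pos (hy n) ih).ne']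
    ring

theorem measurable_posterior [MeasurableSpace 𝒴] {p : 𝒴 → U → ℝ}
    (hp : ∀ u, Measurable fun y => p y u) (u : U) :
    Measurable (Function.uncurry fun (f : U → ℝ) y => p y u * f u / mixture p f y) :=
  (((hp u).comp measurable_snd).mul ((measurable_pi_apply u).comp measurable_fst)).div
    (measurable_mixture_uncurry hp)

theorem measurable_predRec {Ω : Type*} [MeasurableSpace Ω] [MeasurableSpace 𝒴] {p : 𝒴 → U → ℝ}
    (hp : ∀ u, Measurable fun y => p y u) (w : ℕ → ℝ) (f₀ : U → ℝ) {Y : ℕ → Ω → 𝒴}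
    (hY : ∀ n, Measurable (Y n)) (n : ℕ) :
    Measurable[pastFiltration Y hY n]
      fun ω => predRec p w f₀ (fun i => Y (i - 1) ω) n := by
  induction n with
  | zero => exact measurable_const
  | succ n ih =>
    have h1 := ih.mono ((pastFiltration Y hY).mono n.le_succ) le_rfl
    have h2 := measurable_pastFiltration hY n.lt_succ_self
    have h3 : Measurable fun q : (U → ℝ) × 𝒴 => fun u => (1 - w (n + 1)) * q.1 u +
        w (n + 1) * (p q.2 u * q.1 u / mixture p q.1 q.2) :=
      measurable_pi_iff.2 fun u => (((measurable_pi_apply u).comp measurable_fst).const_mul _).add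
        ((measurable_posterior hp u).const_mul _)
    exact h3.comp (h1.prodMk h2)

theorem abs_posterior_le_one {p : 𝒴 → U → ℝ} {y : 𝒴} (hp : ∀ u, 0 ≤ p y u) {f : U → ℝ}
    (hf : ∀ u, 0 ≤ f u) (u : U) : |p y u * f u / mixture p f y| ≤ 1 := by
  rw [abs_of_nonneg (div_nonneg (mul_nonneg (hp u) (hf u)) (mixture_nonneg hp hf))]
  exact mul_div_mixture_le_one hp hf u

/-- Almost sure rate of convergence of the mixing weights. The weight `w 0` is not used by the
recursion; it is taken in `(0, 1)` for uniformity. -/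
theorem IsRegular.ae_isLittleO_deviation {Ω : Type*} [MeasurableSpace Ω] [MeasurableSpace 𝒴]
    {P : Measure Ω} [IsProbabilityMeasure P] {μ : Measure 𝒴} [IsProbabilityMeasure μ]
    {p : 𝒴 → U → ℝ} {fs : U → ℝ} (h : IsRegular μ p fs)
    (hR : ∀ u, ∫ y, p y u / mixture p fs y ∂μ = 1) (hident : Identifiable μ p)
    {Y : ℕ → Ω → 𝒴} (hY : ∀ n, Measurable (Y n)) (hlaw : ∀ n, P.map (Y n) = μ)
    (hindep : iIndepFun Y P) {f₀ : U → ℝ} (hf₀ : f₀ ∈ stdSimplex ℝ U) (hf₀pos : ∀ u, 0 < f₀ u)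
    {w : ℕ → ℝ} (hw : ∀ n, w n ∈ Set.Ioo (0 : ℝ) 1)
    (hdiv : Tendsto (fun N => ∑ n ∈ Finset.range N, w (n + 1)) atTop atTop)
    (hreg : Tendsto (fun n => (w (n + 1))⁻¹ - (w n)⁻¹) atTop (𝓝 0))
    {δ : ℝ} (hδ0 : 0 ≤ δ) (hδ1 : δ ≤ 1)
    (hsum : Summable fun n => (w (n + 1) ^ (1 - δ)) ^ 2) :
    ∀ᵐ ω ∂P, (∀ n, predRec p w f₀ (fun i => Y (i - 1) ω) n ∈ stdSimplex ℝ U) ∧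
      (fun n => deviation fs (predRec p w f₀ (fun i => Y (i - 1) ω) n))
        =o[atTop] fun n => w n ^ δ := by
  obtain ⟨M, hM, hM0, hpos⟩ := h.exists_truncation hR hident
  have hw2 : Summable fun n => w (n + 1) ^ 2 := by
    refine hsum.of_nonneg_of_le (fun n => sq_nonneg _) fun n => ?_
    have h1 : w (n + 1) ≤ w (n + 1) ^ (1 - δ) := by
      have := Real.rpow_le_rpow_of_exponent_ge (hw (n + 1)).1 (hw (n + 1)).2.le
        (by linarith : 1 - δ ≤ 1)
      rwa [Real.rpow_one] at this
    have := (hw (n + 1)).1.le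
    gcongr
  have hwt : Tendsto w atTop (𝓝 0) := by
    rw [← tendsto_add_atTop_iff_nat 1]
    have := hw2.tendsto_atTop_zero.sqrt
    simp only [Real.sqrt_zero] at this
    exact this.congr fun n => Real.sqrt_sq (hw (n + 1)).1.le
  have hX := fun n => measurable_predRec h.measurable w f₀ hY n
  have hX0 : ∀ n ω u, 0 < predRec p w f₀ (fun i => Y (i - 1) ω) n u := fun n ω u =>
    predRec_pos h.nonneg hw hf₀pos _ n u
  have hn1 := ae_tendsto_sum_noise hY hlaw hindep hX
    (measurable_truncRatio_uncurry h.measurable fs M)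
    (fun n ω y => abs_truncRatio_le (h.nonneg y) h.mem (zero_le_one.trans hM)
      fun u => (hX0 n ω u).le) hw2
  have hn2 := ae_all_iff.2 fun u => ae_tendsto_sum_noise hY hlaw hindep hX
    (measurable_posterior h.measurable u)
    (fun n ω y => abs_posterior_le_one (h.nonneg y) (fun u => (hX0 n ω u).le) u) hsum
  have hYpos : ∀ᵐ ω ∂P, ∀ n u, 0 < p (Y n ω) u := by
    refine ae_all_iff.2 fun n => ?_
    exact ae_of_ae_map (hY n).aemeasurable (by rw [hlaw n]; exact h.ae_pos)
  filter_upwards [hn1, hn2, hYpos] with ω h1 h2 h3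
  have hmem := predRec_mem_stdSimplex h.nonneg hw hf₀ hf₀pos (y := fun i => Y (i - 1) ω)
    fun n => h3 n
  have hlim := h.tendsto_of_noise hM hM0 hpos (fun n => hw (n + 1)) hdiv hw2 (y := fun n => Y n ω)
    hmem (fun n u => hX0 n ω u) (fun n u => rfl) h1
  exact ⟨hmem, h.isLittleO_of_noise hR hident (fun n => (hw n).1) hwt hdiv hreg hδ0 hδ1
    (y := fun n => Y n ω) hmem (fun n u => rfl) hlim h2⟩

end Recursion

end PredRec

/-! ### Rates for the mixtures and the divergences -/

theorem corollary1 {Ω 𝒴 U : Type*} [MeasurableSpace Ω] [MeasurableSpace 𝒴] [Fintype U]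
    (P : Measure Ω) [IsProbabilityMeasure P] (ν : Measure 𝒴) [SigmaFinite ν]
    -- the true density and the kernel
    (m : 𝒴 → ℝ) (hm : PredRec.IsDensity ν m)
    (p : 𝒴 → U → ℝ) (hp : ∀ u, PredRec.IsDensity ν fun y => p y u)
    -- identifiability and finiteness of the Kullback-Leibler numbers
    (hident : PredRec.Identifiable (PredRec.law ν m) p)
    (hfin : ∀ f ∈ stdSimplex ℝ U, PredRec.KL ν m (PredRec.mixture p f) < ⊤)
    -- the minimizer, in the interior of the simplex
    (fstar : U → ℝ) (hstar : fstar ∈ stdSimplex ℝ U)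
    (hmin : PredRec.KL ν m (PredRec.mixture p fstar) = PredRec.KLinf ν m p)
    (hint : ∀ u, 0 < fstar u)
    -- independent observations `Y 1, Y 2, …` with density `m`
    (Y : ℕ → Ω → 𝒴) (hlaw : ∀ n, 1 ≤ n → HasLaw (Y n) (PredRec.law ν m) P)
    (hindep : iIndepFun (fun n => Y (n + 1)) P)
    -- the initial value and the weights `w 1, w 2, …`
    (f₀ : U → ℝ) (hf₀ : f₀ ∈ stdSimplex ℝ U) (hf₀pos : ∀ u, 0 < f₀ u)
    (w : ℕ → ℝ) (hw : ∀ n, 1 ≤ n → w n ∈ Set.Ioo (0 : ℝ) 1)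
    (ε : ℝ) (hε : ε ∈ Set.Ioc (0 : ℝ) 1)
    (hwdiv : Tendsto (fun N : ℕ => ∑ n ∈ Finset.Icc 1 N, w n) atTop atTop)
    (hwsum : Summable fun n : ℕ => w (n + 1) ^ (1 + ε))
    (hwreg : Tendsto (fun n : ℕ => (w (n + 1))⁻¹ - (w n)⁻¹) atTop (𝓝 0))
    (δ : ℝ) (hδ : δ ∈ Set.Ioc (0 : ℝ) ((1 - ε) / 2)) :
    (∀ᵐ ω ∂P,
      (fun n : ℕ => ∫ y, |PredRec.mixture p (PredRec.predRec p w f₀ (fun i => Y i ω) n) y -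
          PredRec.mixture p fstar y| ∂ν) =o[atTop] fun n : ℕ => w n ^ δ) ∧
    (∀ᵐ ω ∂P,
      (fun n : ℕ =>
        (PredRec.KL ν m
          (PredRec.mixture p (PredRec.predRec p w f₀ (fun i => Y i ω) n))).toReal -
          (PredRec.KLinf ν m p).toReal) =o[atTop] fun n : ℕ => w n ^ (2 * δ)) := by
  have hμ : IsProbabilityMeasure (PredRec.law ν m) := hm.isProbabilityMeasure_law
  have hreg : PredRec.IsRegular (PredRec.law ν m) p fstar :=
    PredRec.isRegular_law hp hfin hstar hint
  have hdens : ∀ f ∈ stdSimplex ℝ U, PredRec.IsDensity ν (PredRec.mixture p f) := fun f hf =>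
    PredRec.isDensity_mixture hp hf
  have hKLsub : ∀ f ∈ stdSimplex ℝ U, (PredRec.KL ν m (PredRec.mixture p f)).toReal -
      (PredRec.KLinf ν m p).toReal = -∫ y, Real.log (PredRec.mixture p f y /
        PredRec.mixture p fstar y) ∂PredRec.law ν m := fun f hf => by
    rw [← hmin]
    exact PredRec.toReal_KL_sub hm (hdens f hf) (hdens _ hstar) (hfin f hf) (hfin _ hstar)
  have hKLnonneg : ∀ f ∈ stdSimplex ℝ U, 0 ≤ (PredRec.KL ν m (PredRec.mixture p f)).toReal -
      (PredRec.KLinf ν m p).toReal := fun f hf =>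
    sub_nonneg.2 (ENNReal.toReal_mono (hfin f hf).ne (iInf₂_le f hf))
  have hR := hreg.integral_div_eq_one fun f hf => by
    have h1 := hKLsub f hf
    have h2 := hKLnonneg f hf
    linarith
  -- measurable versions of the observations, and weights with an admissible value at zero
  set Y' : ℕ → Ω → 𝒴 := fun n => (hlaw (n + 1) n.succ_pos).aemeasurable.mk with hY'
  have hYY' : ∀ n, Y (n + 1) =ᵐ[P] Y' n := fun n =>
    (hlaw (n + 1) n.succ_pos).aemeasurable.ae_eq_mk
  have hY'm : ∀ n, Measurable (Y' n) := fun n =>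
    (hlaw (n + 1) n.succ_pos).aemeasurable.measurable_mk
  have hY'law : ∀ n, P.map (Y' n) = PredRec.law ν m := fun n => by
    rw [← Measure.map_congr (hYY' n), (hlaw (n + 1) n.succ_pos).map_eq]
  have hY'indep : iIndepFun Y' P := hindep.congr hYY'
  set w' : ℕ → ℝ := fun n => w (max n 1) with hw'
  have hw'succ : ∀ n, w' (n + 1) = w (n + 1) := fun n => by simp [hw']
  have hw'eq : ∀ᶠ n in atTop, w' n = w n := by
    filter_upwards [eventually_ge_atTop 1] with n hn
    simp [hw', hn]
  have hw'mem : ∀ n, w' n ∈ Set.Ioo (0 : ℝ) 1 := fun n => hw _ (le_max_right _ _)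
  have hdiv : Tendsto (fun N => ∑ n ∈ Finset.range N, w' (n + 1)) atTop atTop := by
    refine hwdiv.congr fun N => ?_
    simp only [hw'succ]
    rw [Finset.range_eq_Ico, Finset.sum_Ico_add' w 0 N 1]
    rfl
  have hreg' : Tendsto (fun n => (w' (n + 1))⁻¹ - (w' n)⁻¹) atTop (𝓝 0) := by
    refine hwreg.congr' ?_
    filter_upwards [hw'eq] with n hn
    rw [hw'succ, hn]
  have hδ1 : δ ≤ 1 := by have := hδ.2; have := hε.1; linarith
  have hsum : Summable fun n => (w' (n + 1) ^ (1 - δ)) ^ 2 := by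
    refine hwsum.of_nonneg_of_le (fun n => sq_nonneg _) fun n => ?_
    rw [hw'succ]
    have hwn := hw (n + 1) n.succ_pos
    rw [← Real.rpow_natCast, ← Real.rpow_mul hwn.1.le]
    refine Real.rpow_le_rpow_of_exponent_ge hwn.1 hwn.2.le ?_
    have := hδ.2
    push_cast
    linarith
  have main := hreg.ae_isLittleO_deviation hR hident hY'm hY'law hY'indep hf₀ hf₀pos hw'mem hdiv
    hreg' hδ.1.le hδ1 hsum
  have key : ∀ᵐ ω ∂P,
      (∀ n, PredRec.predRec p w f₀ (fun i => Y i ω) n ∈ stdSimplex ℝ U) ∧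
      (fun n => ∑ u, |PredRec.predRec p w f₀ (fun i => Y i ω) n u - fstar u| / fstar u)
        =o[atTop] fun n => w n ^ δ := by
    filter_upwards [main, ae_all_iff.2 hYY'] with ω hω hYω
    have e : ∀ n, PredRec.predRec p w f₀ (fun i => Y i ω) n =
        PredRec.predRec p w' f₀ (fun i => Y' (i - 1) ω) n := fun n =>
      PredRec.predRec_congr p (fun n => (hw'succ n).symm) f₀ (fun n => hYω n) n
    simp only [e]
    refine ⟨hω.1, IsBigO.trans_isLittleO ?_ (hω.2.congr' EventuallyEq.rfl ?_)⟩
    · refine IsBigO.of_bound (∑ u, (√(fstar u))⁻¹) (Eventually.of_forall fun n => ?_)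
      rw [Real.norm_eq_abs, abs_of_nonneg (Finset.sum_nonneg fun u _ =>
        div_nonneg (abs_nonneg _) (hint u).le)]
      exact PredRec.sum_abs_sub_div_le hint _
    · filter_upwards [hw'eq] with n hn
      rw [hn]
  have hfs1 : ∀ u, fstar u ≤ 1 := fun u => by
    rw [← hstar.2]; exact Finset.single_le_sum (fun u _ => hstar.1 u) (Finset.mem_univ u)
  constructor
  · filter_upwards [key] with ω hω
    refine IsBigO.trans_isLittleO ?_ hω.2
    refine IsBigO.of_bound 1 (Eventually.of_forall fun n => ?_)
    rw [one_mul, Real.norm_eq_abs, Real.norm_eq_abs,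
      abs_of_nonneg (integral_nonneg fun y => abs_nonneg _),
      abs_of_nonneg (Finset.sum_nonneg fun u _ => div_nonneg (abs_nonneg _) (hint u).le)]
    refine (PredRec.integral_abs_mixture_sub_le hp _ _).trans (Finset.sum_le_sum fun u _ => ?_)
    exact le_div_self (abs_nonneg _) (hint u) (hfs1 u)
  · filter_upwards [key] with ω hω
    have hsmall : ∀ᶠ n in atTop,
        ∑ u, |PredRec.predRec p w f₀ (fun i => Y i ω) n u - fstar u| / fstar u ≤ 1 / 2 := by
      filter_upwards [hω.2.bound (by norm_num : (0 : ℝ) < 1 / 2), eventually_ge_atTop 1]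
        with n hn hn1
      have hwn := hw n hn1
      have h1 : w n ^ δ ≤ 1 := Real.rpow_le_one hwn.1.le hwn.2.le hδ.1.le
      rw [Real.norm_eq_abs, Real.norm_eq_abs, abs_of_pos (Real.rpow_pos_of_pos hwn.1 δ)] at hn
      have h2 := le_abs_self
        (∑ u, |PredRec.predRec p w f₀ (fun i => Y i ω) n u - fstar u| / fstar u)
      linarith
    have hsq := hω.2.pow (n := 2) two_pos
    refine IsBigO.trans_isLittleO ?_ (hsq.congr' EventuallyEq.rfl ?_)
    · refine IsBigO.of_bound 2 ?_
      filter_upwards [hsmall] with n hn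
      have hmem := hω.1 n
      have h1 := hreg.le_integral_log hn
      -- the first-order term vanishes, since both vectors have total mass one
      simp only [hR, mul_one, Finset.sum_sub_distrib, hmem.2, hstar.2, sub_self, zero_sub] at h1
      rw [Real.norm_eq_abs, abs_of_nonneg (hKLnonneg _ hmem), hKLsub _ hmem, Real.norm_eq_abs,
        abs_of_nonneg (sq_nonneg _)]
      linarith
    · filter_upwards [eventually_ge_atTop 1] with n hn
      rw [← Real.rpow_natCast, ← Real.rpow_mul (hw n hn).1.le, mul_comm δ]
      norm_num
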